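/- Setting. Let $q$ be a probability distribution on $\mathcal X\times\mathcal Y$ (the distribution from which training samples are drawn), let $\ell(\theta;x,y)$, $\theta\in\mathbb R^d$, be a loss, and put $\mathcal L(\theta)=\mathbb E_{q}[\ell(\theta;x,y)]$. Let $p_\theta(x,y)=q(x)\,p_\theta(y\mid x)$ be the model distributions, where $q(x)$ is the input marginal of $q$. Define the Hessian, the Fisher information matrix and the gradient covariance by $$H(\theta)=\mathbb E_{q}\big[\partial^2_\theta\ell(\theta;x,y)\big],\qquad F(\theta)=\mathbb E_{p_\theta}\big[\partial^2_\theta\ell(\theta;x,y)\big],\qquad C(\theta)=\mathrm{Cov}_{q}\big[\nabla_\theta\ell(\theta;x,y)\big].$$ Let $\hat\theta^\star$ be a local minimum of $\mathcal L$, let $\mathbb B$ be a compact convex set with $\hat\theta^\star$ in its interior, and put $C=C(\hat\theta^\star)$. Assumptions. (a) Realizability: $p_{\hat\theta^\star}=q$. (b) The initial weight $\theta_0$ lies in $\mathbb B$ almost surely. (c) For $q$-almost every $(x,y)$ the loss $\ell(\cdot;x,y)$ is differentiable on $\mathbb B$ with $\|\nabla_\theta\ell(\theta;x,y)\|\le L$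 for all $\theta\in\mathbb B$, so that $\ell(\cdot;x,y)$ is Lipschitz on $\mathbb B$ with constant $L$; and $\ell(\theta;x,y)$ is $q$-integrable for $\theta\in\mathbb B$. (d) $H(\theta)$, $F(\theta)$, $C(\theta)$ are positive definite for $\theta\in\mathbb B$. (e) $\mathcal L$ is strongly convex on $\mathbb B$ with some constant $\mu>0$. (f) Regularity: for $q$-almost every $(x,y)$ the loss $\ell(\cdot;x,y)$ is twice differentiable on $\mathbb B$, and its gradient and its Hessian are Lipschitz on $\mathbb B$ with constants that do not depend on $(x,y)$. The step sizes are $\eta_k=c\,(k+1)^{-\alpha}$ with $c>0$ and $\tfrac12<\alpha<1$. The $k$-th mini-batch $\mathcal D_k$ consists of $b_k\ge1$ samples, each with distribution $q$ (they may depend on one another), and is independent of $\theta_0,\mathcal D_0,\dots,\mathcal D_{k-1}$. Consider first-order SGD $$\theta_{k+1}=\theta_k-\eta_k\,\frac1{b_k}\sum_{(x,y)\in\mathcal D_k}\nabla_\theta\ell(\theta_k;x,y),\qquad \bar\theta_k=\frac1{k+1}\sum_{i=0}^k\theta_i,$$ let $A_k=\{\theta_0,\dots,\theta_k\in\mathbb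 B\}$, and let $(x,y)\sim q$ be independent of the run. Theorem. There is a sequence $r_k=o\big(1/\sqrt{k+1}\big)$ such that for every $k\ge0$ the expectations below exist and $$\mathbb E\big[\big(\ell(\bar\theta_k;x,y)-\ell(\hat\theta^\star;x,y)\big)\mathbf 1_{A_k}\big]\;\le\;L\;\mathbb E\big[\|\bar\theta_k-\hat\theta^\star\|^2\,\mathbf 1_{A_k}\big]^{1/2}\;\le\;L\,\frac{\mathrm{Tr}\big(F(\hat\theta^\star)^{-1}\big)\sqrt{\mathrm{Tr}(C)}}{\sqrt{k+1}}+r_k .$$ If moreover the iterates $\theta_0,\dots,\theta_k$ lie in $\mathbb B$ almost surely, then, with the same $r_k$, $$\mathbb E\big[\ell(\bar\theta_k;x,y)-\ell(\hat\theta^\star;x,y)\big]\;\le\;L\;\mathbb E\big[\|\bar\theta_k-\hat\theta^\star\|^2\big]^{1/2}\;\le\;L\,\frac{\mathrm{Tr}\big(F(\hat\theta^\star)^{-1}\big)\sqrt{\mathrm{Tr}(C)}}{\sqrt{k+1}}+r_k .$$ -/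

import Mathlib

open MeasureTheory ProbabilityTheory Filter Topology Set Asymptotics
open scoped NNReal ENNReal

/-- The parameter space `ℝ^d` with its Euclidean norm. -/
abbrev Param (d : ℕ) : Type := EuclideanSpace ℝ (Fin d)

noncomputable section

/-- The gradient `∇_θ ℓ(θ; z)` of the loss of one sample `z`. -/
def sampleGrad {d : ℕ} {Z : Type*} (ℓ : Param d → Z → ℝ) (z : Z) (θ : Param d) : Param d :=
  gradient (fun ϑ => ℓ ϑ z) θ

/-- The Hessian `∂²ℓ(θ; z) / ∂θ ∂θᵀ` of the loss of one sample `z`, as an operator on `ℝ^d`. -/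
def sampleHess {d : ℕ} {Z : Type*} (ℓ : Param d → Z → ℝ) (z : Z) (θ : Param d) :
    Param d →L[ℝ] Param d :=
  fderiv ℝ (sampleGrad ℓ z) θ

/-- The expected loss `𝓛(θ) = 𝔼_{z ∼ q}[ℓ(θ; z)]`. -/
def expectedLoss {d : ℕ} {Z : Type*} [MeasurableSpace Z] (ℓ : Param d → Z → ℝ)
    (q : Measure Z) (θ : Param d) : ℝ :=
  ∫ z, ℓ θ z ∂q

/-- The `d × d` matrix `𝔼_{z ∼ ρ}[∂²ℓ(θ; z) / ∂θ ∂θᵀ]`. -/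
def meanHessian {d : ℕ} {Z : Type*} [MeasurableSpace Z] (ℓ : Param d → Z → ℝ)
    (ρ : Measure Z) (θ : Param d) : Matrix (Fin d) (Fin d) ℝ :=
  Matrix.of fun i j => ∫ z, (sampleHess ℓ z θ (EuclideanSpace.single j 1)) i ∂ρ

/-- The model distribution `p_θ(x, y) = q(x) p_θ(y | x)`: the input marginal of `q` together with
the conditional distribution `κ θ = p_θ(· | ·)` of the output given the input. -/
def modelDistribution {d : ℕ} {X Y : Type*} [MeasurableSpace X] [MeasurableSpace Y]
    (q : Measure (X × Y)) (κ : Param d → Kernel X Y) (θ : Param d) : Measure (X × Y) :=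
  q.fst ⊗ₘ (κ θ)

/-- The Fisher information matrix `F(θ) = 𝔼_{p_θ}[∂²ℓ(θ; x, y) / ∂θ ∂θᵀ]`: the mean Hessian of the
loss under the model's own distribution `p_θ`. -/
def fisherMatrix {d : ℕ} {X Y : Type*} [MeasurableSpace X] [MeasurableSpace Y]
    (ℓ : Param d → X × Y → ℝ) (q : Measure (X × Y)) (κ : Param d → Kernel X Y)
    (θ : Param d) : Matrix (Fin d) (Fin d) ℝ :=
  meanHessian ℓ (modelDistribution q κ θ) θ

/-- The covariance matrix under `q` of the sample gradient at `θ`. -/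
def gradCovariance {d : ℕ} {Z : Type*} [MeasurableSpace Z] (ℓ : Param d → Z → ℝ)
    (q : Measure Z) (θ : Param d) : Matrix (Fin d) (Fin d) ℝ :=
  Matrix.of fun i j => cov[fun z => sampleGrad ℓ z θ i, fun z => sampleGrad ℓ z θ j; q]

/-- The mini-batch gradient: the average of the sample gradients over the batch. -/
def batchGrad {d : ℕ} {Z : Type*} (ℓ : Param d → Z → ℝ) {n : ℕ} (batch : Fin n → Z)
    (θ : Param d) : Param d :=
  (n : ℝ)⁻¹ • ∑ j, sampleGrad ℓ (batch j) θ

/-- First-order stochastic gradient descent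
`θ_{k+1} = θ_k - η_k ∇ℓ(θ_k; 𝒟_k)` started from `θ_0 = init`, where `b k` is the size of the
`k`-th mini-batch `𝒟_k = D k`. -/
def sgd {d : ℕ} {Ω Z : Type*} (ℓ : Param d → Z → ℝ) (η : ℕ → ℝ) (b : ℕ → ℕ)
    (D : (k : ℕ) → Ω → Fin (b k) → Z) (init : Ω → Param d) : ℕ → Ω → Param d
  | 0 => init
  | k + 1 => fun ω =>
      sgd ℓ η b D init k ω - η k • batchGrad ℓ (D k ω) (sgd ℓ η b D init k ω)

/-- The average `(1 / (k + 1)) ∑_{i=0}^{k} θ_i` of the iterates up to time `k`. -/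
def averageIterate {d : ℕ} {Ω : Type*} (θ : ℕ → Ω → Param d) (k : ℕ) (ω : Ω) : Param d :=
  ((k : ℝ) + 1)⁻¹ • ∑ i ∈ Finset.range (k + 1), θ i ω

/-- The event that the iterates `θ_0, …, θ_k` all lie in `B`. -/
def stayIn {d : ℕ} {Ω : Type*} (B : Set (Param d)) (θ : ℕ → Ω → Param d) (k : ℕ) : Set Ω :=
  {ω | ∀ i ≤ k, θ i ω ∈ B}

end

/-! This is Polyak–Ruppert averaging. Write Δ_i = θ_i - θs, let H be the mean Hessian at θs, and
split the batch gradient g_i at θ_i into the mean gradient plus a noise ξ_i. The mean gradient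
vanishes at θs, hence equals H Δ_i up to O(‖Δ_i‖²), and H ∑ Δ_i = ∑ g_i - ∑ ξ_i - ∑ O(‖Δ_i‖²)
(`RegularLoss.norm_meanHessian_sum_le`). Each sum is measured in L² over A_k.

The noises are orthogonal martingale increments whose variances approach at most Tr C, so their sum
contributes √((k+1) Tr C) + o(√k), the leading term
(`SGDRun.setIntegral_norm_accumulatedNoise_sq_le`). Since g_i = (Δ_i - Δ_{i+1}) / η_i, summation by
parts makes ∑ g_i of order η_k^(-1/2), which is o(√k) because α < 1
(`SGDRun.norm_sum_batchGrad_le`). The quadratic remainders are O(∑ η_i), which is o(√k) because α >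
1/2. These orders rest on the moment bounds E[‖Δ_k‖² 1_{A_k}] = O(η_k) and E[‖Δ_k‖⁴ 1_{A_k}] =
O(η_k²), which strong convexity yields through contracting recursions
(`SGDRun.exists_moment_bounds`).

Inverting H costs the operator norm of H⁻¹, at most its trace (`norm_le_trace_inv_mul_norm`), and H
= F at θs by realizability. Dividing by k + 1 gives the second inequality. The first is the
Lipschitz bound followed by Jensen (`RegularLoss.integral_excess_le`).

Working on A_k costs nothing: A_k is determined before batch k is drawn, so conditioning on the past
respects it, and the A_k decrease, so integrals of nonnegative functions over A_{k+1} are bounded by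
those over A_k. -/

open scoped RealInnerProductSpace

/-! ### Scalar recursions, step sizes and asymptotics. -/

/-- A Chung-type lemma: a recursion `u (k+1) ≤ (1 - a η) u k + M η ^ (p + 1)` with slowly decreasing
steps `η` forces `u k = O(η ^ p)`. -/
theorem exists_le_mul_pow_of_recursion {u η : ℕ → ℝ} {a M : ℝ} (p : ℕ) (ha : 0 < a) (hM : 0 ≤ M)
    (hη : ∀ k, 0 < η k) (hη0 : Tendsto η atTop (𝓝 0))
    (hslow : ∀ ε > 0, ∀ᶠ k in atTop, η k * (1 - ε * η k) ≤ η (k + 1))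
    (hu : ∀ k, u (k + 1) ≤ (1 - a * η k) * u k + M * η k ^ (p + 1)) :
    ∃ C, 0 ≤ C ∧ ∀ k, u k ≤ C * η k ^ p := by
  -- With this `ε`, Bernoulli's inequality loses at most pε ≤ a/2 in comparing η_k^p with η_{k+1}^p.
  -- Half of the contraction remains, and the term 2M/a in `C` lets it absorb M.
  set ε := a / (2 * (p + 1)) with hε
  have hε0 : 0 < ε := by positivity
  have e1 : ∀ᶠ k in atTop, η k < 1 / a := hη0.eventually_lt_const (by positivity)
  have e2 : ∀ᶠ k in atTop, η k < 1 / ε := hη0.eventually_lt_const (by positivity)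
  obtain ⟨N, hN⟩ := eventually_atTop.1 (e1.and (e2.and (hslow ε hε0)))
  -- The sum secures the claim up to `N`, before the steps are small enough for the recursion to
  -- contract.
  set C := 2 * M / a + ∑ k ∈ Finset.range (N + 1), |u k| / η k ^ p with hC
  have hsum : ∀ k, 0 ≤ |u k| / η k ^ p := fun k => by have := hη k; positivity
  have hCM : 2 * M / a ≤ C := le_add_of_nonneg_right (Finset.sum_nonneg fun k _ => hsum k)
  have hC0 : 0 ≤ C := le_trans (by positivity) hCM
  have hstart : ∀ k ≤ N, u k ≤ C * η k ^ p := by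
    intro k hk
    have h1 : |u k| / η k ^ p ≤ C := by
      have := Finset.single_le_sum (f := fun k => |u k| / η k ^ p) (fun k _ => hsum k)
        (Finset.mem_range.2 (Nat.lt_succ_of_le hk))
      have h2 : 0 ≤ 2 * M / a := by positivity
      linarith
    rw [div_le_iff₀ (pow_pos (hη k) p)] at h1
    exact (le_abs_self _).trans h1
  refine ⟨C, hC0, fun k => ?_⟩
  rcases le_total k N with hk | hk
  · exact hstart k hk
  induction k, hk using Nat.le_induction with
  | base => exact hstart N le_rfl
  | succ k hk ih =>
    obtain ⟨h1, h2, h3⟩ := hN k hk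
    have hk0 := hη k
    rw [lt_div_iff₀ ha] at h1
    rw [lt_div_iff₀ hε0] at h2
    have hpow : η k ^ p * (1 - a / 2 * η k) ≤ η (k + 1) ^ p := by
      have hb : 1 + (p : ℝ) * (-(ε * η k)) ≤ (1 + -(ε * η k)) ^ p :=
        one_add_mul_le_pow (by nlinarith) p
      have hp : (p : ℝ) * ε ≤ a / 2 := by
        rw [hε, mul_div_assoc', div_le_div_iff₀ (by positivity) (by positivity)]
        nlinarith
      calc η k ^ p * (1 - a / 2 * η k) ≤ η k ^ p * (1 + -(ε * η k)) ^ p := by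
            gcongr
            nlinarith
        _ = (η k * (1 - ε * η k)) ^ p := by rw [← mul_pow]; ring
        _ ≤ η (k + 1) ^ p := by
            apply pow_le_pow_left₀ _ h3
            exact mul_nonneg hk0.le (by nlinarith)
    have hM' : M ≤ a / 2 * C := by
      rw [div_le_iff₀ ha] at hCM
      linarith
    calc u (k + 1) ≤ (1 - a * η k) * u k + M * η k ^ (p + 1) := hu k
      _ ≤ (1 - a * η k) * (C * η k ^ p) + (a / 2 * C) * η k ^ (p + 1) := by
          gcongr
          nlinarith
      _ = C * (η k ^ p * (1 - a / 2 * η k)) := by ring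
      _ ≤ C * η (k + 1) ^ p := by gcongr

theorem tendsto_natCast_add_one_atTop : Tendsto (fun k : ℕ => (k : ℝ) + 1) atTop atTop :=
  tendsto_atTop_add_const_right _ _ tendsto_natCast_atTop_atTop

theorem tendsto_polynomial_step {c α : ℝ} (hα : 0 < α) :
    Tendsto (fun k : ℕ => c * ((k : ℝ) + 1) ^ (-α)) atTop (𝓝 0) := by
  simpa using ((tendsto_rpow_neg_atTop hα).comp tendsto_natCast_add_one_atTop).const_mul c

/-- One iteration decreases the step by a relative amount of at most 1/(k+1), and this is o(η_k)
exactly because α < 1. -/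
theorem polynomial_step_slow {c α : ℝ} (hc : 0 < c) (hα0 : 0 < α) (hα : α < 1) {ε : ℝ}
    (hε : 0 < ε) : ∀ᶠ k : ℕ in atTop,
      (c * ((k : ℝ) + 1) ^ (-α)) * (1 - ε * (c * ((k : ℝ) + 1) ^ (-α))) ≤
        c * (((k + 1 : ℕ) : ℝ) + 1) ^ (-α) := by
  have h1 : Tendsto (fun k : ℕ => ((k : ℝ) + 1) ^ (1 - α)) atTop atTop :=
    (tendsto_rpow_atTop (by linarith)).comp tendsto_natCast_add_one_atTop
  filter_upwards [h1.eventually_ge_atTop (1 / (ε * c))] with k hk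
  set x : ℝ := (k : ℝ) + 1 with hx
  have hx0 : 0 < x := by positivity
  have hxc : (((k + 1 : ℕ) : ℝ) + 1) = x + 1 := by push_cast; ring
  rw [hxc]
  have h2 : 1 / x ≤ ε * (c * x ^ (-α)) := by
    rw [div_le_iff₀ (by positivity)] at hk
    rw [div_le_iff₀ hx0]
    have : x ^ (1 - α) = x ^ (-α) * x := by
      rw [sub_eq_neg_add, Real.rpow_add_one hx0.ne']
    rw [this] at hk
    linarith
  have h3 : x ^ (-α) * (1 - 1 / x) ≤ (x + 1) ^ (-α) := by
    have h4 : (x / (x + 1)) ^ (1 : ℝ) ≤ (x / (x + 1)) ^ α :=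
      Real.rpow_le_rpow_of_exponent_ge (by positivity)
        ((div_le_one (by positivity)).2 (by linarith)) hα.le
    rw [Real.rpow_one, Real.div_rpow hx0.le (by positivity)] at h4
    have h5 : 1 - 1 / x ≤ x / (x + 1) := by
      rw [sub_le_iff_le_add, div_add_div _ _ (by positivity) (by positivity),
        le_div_iff₀ (by positivity)]
      nlinarith
    rw [Real.rpow_neg hx0.le, Real.rpow_neg (by positivity)]
    calc (x ^ α)⁻¹ * (1 - 1 / x) ≤ (x ^ α)⁻¹ * (x ^ α / (x + 1) ^ α) := by
          gcongr
          exact h5.trans h4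
      _ = ((x + 1) ^ α)⁻¹ := by
          have : x ^ α ≠ 0 := by positivity
          field_simp
  calc c * x ^ (-α) * (1 - ε * (c * x ^ (-α))) ≤ c * x ^ (-α) * (1 - 1 / x) := by gcongr
    _ = c * (x ^ (-α) * (1 - 1 / x)) := by ring
    _ ≤ c * (x + 1) ^ (-α) := by gcongr

/-- Sums of `o(1 / √k)` terms are `o(√k)`. -/
theorem isLittleO_sum_of_isLittleO_one_div_sqrt {f : ℕ → ℝ}
    (hf : f =o[atTop] fun k : ℕ => 1 / √((k : ℝ) + 1)) :
    (fun k => ∑ i ∈ Finset.range (k + 1), f i) =o[atTop] fun k : ℕ => √((k : ℝ) + 1) := by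
  -- The lower bound gives the divergence that `IsLittleO.sum_range` requires; the upper bound `hup`
  -- turns its conclusion into o(√n).
  have hlow : ∀ n : ℕ, √(n : ℝ) ≤ ∑ i ∈ Finset.range n, 1 / √((i : ℝ) + 1) := by
    intro n
    induction n with
    | zero => simp
    | succ n ih =>
      rw [Finset.sum_range_succ]
      refine le_trans ?_ (add_le_add_left ih _)
      have h1 : 0 < √((n : ℝ) + 1) := by positivity
      have h2 := Real.sq_sqrt (show (0 : ℝ) ≤ n by positivity)
      have h3 := Real.sq_sqrt (show (0 : ℝ) ≤ (n : ℝ) + 1 by positivity)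
      have h4 : √(n : ℝ) ≤ √((n : ℝ) + 1) := Real.sqrt_le_sqrt (by linarith)
      push_cast
      rw [← sub_le_iff_le_add', le_div_iff₀ h1]
      nlinarith [Real.sqrt_nonneg (n : ℝ)]
  have hup : ∀ n : ℕ, ∑ i ∈ Finset.range n, 1 / √((i : ℝ) + 1) ≤ 2 * √(n : ℝ) := by
    intro n
    induction n with
    | zero => simp
    | succ n ih =>
      rw [Finset.sum_range_succ]
      refine le_trans (add_le_add_left ih _) ?_
      have h1 : 0 < √((n : ℝ) + 1) := by positivity
      have h2 := Real.sq_sqrt (show (0 : ℝ) ≤ n by positivity)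
      have h3 := Real.sq_sqrt (show (0 : ℝ) ≤ (n : ℝ) + 1 by positivity)
      push_cast
      rw [← le_sub_iff_add_le', div_le_iff₀ h1]
      nlinarith [sq_nonneg (√((n : ℝ) + 1) - √(n : ℝ))]
  have hsum := hf.sum_range (fun n => by positivity)
    (tendsto_atTop_mono hlow (Real.tendsto_sqrt_atTop.comp tendsto_natCast_atTop_atTop))
  have hbig : (fun n : ℕ => ∑ i ∈ Finset.range n, 1 / √((i : ℝ) + 1)) =O[atTop]
      fun n : ℕ => √(n : ℝ) := by
    refine IsBigO.of_bound 2 (Eventually.of_forall fun n => ?_)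
    rw [Real.norm_of_nonneg (Finset.sum_nonneg fun i _ => by positivity),
      Real.norm_of_nonneg (Real.sqrt_nonneg _)]
    exact hup n
  have := (hsum.trans_isBigO hbig).comp_tendsto (tendsto_add_atTop_nat 1)
  simpa [Function.comp_def] using this

/-- Cesàro means of a null sequence. -/
theorem isLittleO_sum_of_tendsto_zero {f : ℕ → ℝ} (hf : Tendsto f atTop (𝓝 0)) :
    (fun k => ∑ i ∈ Finset.range (k + 1), f i) =o[atTop] fun k : ℕ => (k : ℝ) + 1 := by
  have h := (isLittleO_sum_range_of_tendsto_zero hf).comp_tendsto (tendsto_add_atTop_nat 1)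
  simpa [Function.comp_def] using h

theorem isLittleO_sqrt {f g : ℕ → ℝ} (h : f =o[atTop] g) (hf : ∀ k, 0 ≤ f k)
    (hg : ∀ k, 0 ≤ g k) : (fun k => √(f k)) =o[atTop] fun k => √(g k) := by
  rw [isLittleO_iff] at h ⊢
  intro ε hε
  filter_upwards [h (show 0 < ε ^ 2 by positivity)] with k hk
  rw [Real.norm_of_nonneg (hf k), Real.norm_of_nonneg (hg k)] at hk
  rw [Real.norm_of_nonneg (Real.sqrt_nonneg _), Real.norm_of_nonneg (Real.sqrt_nonneg _)]
  calc √(f k) ≤ √(ε ^ 2 * g k) := Real.sqrt_le_sqrt hk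
    _ = ε * √(g k) := by rw [Real.sqrt_mul (by positivity), Real.sqrt_sq hε.le]

/-! ### Taylor remainders and the trace bound for an inverse matrix. -/

/-- First-order Taylor expansion with a quadratic remainder, on a convex set where the derivative
is Lipschitz. -/
theorem norm_sub_sub_fderiv_le {E F : Type*} [NormedAddCommGroup E] [NormedSpace ℝ E]
    [NormedAddCommGroup F] [NormedSpace ℝ F] {g : E → F} {B : Set E} (hB : Convex ℝ B)
    (hg : ∀ x ∈ B, DifferentiableAt ℝ g x) {K : ℝ≥0} (hK : LipschitzOnWith K (fderiv ℝ g) B)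
    {x y : E} (hx : x ∈ B) (hy : y ∈ B) :
    ‖g y - g x - fderiv ℝ g x (y - x)‖ ≤ K * ‖y - x‖ ^ 2 := by
  have hseg : segment ℝ x y ⊆ B := hB.segment_subset hx hy
  -- Mean value inequality for g minus its linear part at x: on the segment the derivative stays
  -- within K‖y - x‖ of `fderiv ℝ g x`. This gives K in place of the sharp K/2.
  have h := (convex_segment (𝕜 := ℝ) x y).norm_image_sub_le_of_norm_hasFDerivWithin_le'
    (f := g) (f' := fderiv ℝ g) (φ := fderiv ℝ g x) (C := K * ‖y - x‖)
    (fun w hw => (hg w (hseg hw)).hasFDerivAt.hasFDerivWithinAt)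
    (fun w hw => ?_) (left_mem_segment ℝ x y) (right_mem_segment ℝ x y)
  · calc _ ≤ K * ‖y - x‖ * ‖y - x‖ := h
      _ = _ := by ring
  · refine (hK.norm_sub_le (hseg hw) hx).trans ?_
    gcongr
    obtain ⟨t, ht, rfl⟩ := (segment_eq_image' ℝ x y ▸ hw)
    simp only [add_sub_cancel_left, norm_smul, Real.norm_eq_abs, abs_of_nonneg ht.1]
    exact mul_le_of_le_one_left (norm_nonneg _) ht.2

theorem abs_sub_sub_inner_gradient_le {E : Type*} [NormedAddCommGroup E] [InnerProductSpace ℝ E]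
    [CompleteSpace E] {f : E → ℝ} {B : Set E} (hB : Convex ℝ B)
    (hf : ∀ x ∈ B, DifferentiableAt ℝ f x) {K : ℝ≥0} (hK : LipschitzOnWith K (gradient f) B)
    {x y : E} (hx : x ∈ B) (hy : y ∈ B) :
    |f y - f x - ⟪gradient f x, y - x⟫| ≤ K * ‖y - x‖ ^ 2 := by
  have hd : ∀ w, fderiv ℝ f w = InnerProductSpace.toDual ℝ E (gradient f w) := fun w => by
    simp [gradient]
  have hK' : LipschitzOnWith K (fderiv ℝ f) B := by
    refine LipschitzOnWith.of_dist_le_mul fun a ha c hc => ?_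
    rw [hd, hd, LinearIsometryEquiv.dist_map]
    exact hK.dist_le_mul a ha c hc
  have h := norm_sub_sub_fderiv_le hB hf hK' hx hy
  rwa [hd, InnerProductSpace.toDual_apply_apply, Real.norm_eq_abs] at h

theorem norm_gradient_eq {E : Type*} [NormedAddCommGroup E] [InnerProductSpace ℝ E]
    [CompleteSpace E] (f : E → ℝ) (x : E) : ‖gradient f x‖ = ‖fderiv ℝ f x‖ := by
  simp [gradient]

/-- The operator norm of the inverse of a positive definite matrix is at most its trace. -/
theorem norm_le_trace_inv_mul_norm {d : ℕ} {M : Matrix (Fin d) (Fin d) ℝ} (hM : M.PosDef)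
    (v : Param d) : ‖v‖ ≤ M⁻¹.trace * ‖Matrix.toEuclideanLin M v‖ := by
  have hN := hM.inv.posSemidef
  set N := M⁻¹ with hNdef
  set w : Param d := Matrix.toEuclideanLin M v with hw
  have hv : ∀ i, v i = ∑ j, N i j * w j := by
    intro i
    have h1 : N.mulVec (M.mulVec v.ofLp) = v.ofLp := by
      rw [Matrix.mulVec_mulVec, hNdef, Matrix.nonsing_inv_mul _ ((Matrix.isUnit_iff_isUnit_det M).1 hM.isUnit),
        Matrix.one_mulVec]
    calc v i = (N.mulVec (M.mulVec v.ofLp)) i := by rw [h1]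
      _ = _ := rfl
  -- Principal 2 × 2 minors of a positive semidefinite matrix are nonnegative (for i = j the
  -- determinant is zero). Summed over i and j, this bounds the Frobenius norm of N by its trace.
  have hminor : ∀ i j, N i j ^ 2 ≤ N i i * N j j := by
    intro i j
    have h := (hN.submatrix ![i, j]).det_nonneg
    rw [Matrix.det_fin_two] at h
    have hs : N j i = N i j := by simpa using hN.isHermitian.apply i j
    simp [hs] at h
    nlinarith
  have htr : 0 ≤ N.trace := hN.trace_nonneg
  refine le_of_sq_le_sq ?_ (by positivity)
  rw [mul_pow, EuclideanSpace.real_norm_sq_eq v, EuclideanSpace.real_norm_sq_eq w]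
  calc ∑ i, v i ^ 2 ≤ ∑ i, (∑ j, N i j ^ 2) * ∑ j, w j ^ 2 := by
        refine Finset.sum_le_sum fun i _ => ?_
        rw [hv i]
        exact Finset.sum_mul_sq_le_sq_mul_sq _ _ _
    _ ≤ ∑ i, (∑ j, N i i * N j j) * ∑ j, w j ^ 2 := by
        gcongr with i _ j _
        exact hminor i j
    _ = N.trace ^ 2 * ∑ j, w j ^ 2 := by
        rw [← Finset.sum_mul, ← Finset.sum_mul_sum, sq]
        rfl

/-! ### The expected loss: mean gradient, mean Hessian, gradient variance. -/

/-- A loss that is `q`-almost surely twice differentiable on the convex set `B`, with gradients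
bounded by `L`, and with gradients and Hessians that are Lipschitz with constants `K₁`, `K₂`. -/
structure RegularLoss {d : ℕ} {Z : Type*} [MeasurableSpace Z] (ℓ : Param d → Z → ℝ)
    (q : Measure Z) (B : Set (Param d)) (L : ℝ) (K₁ K₂ : ℝ≥0) : Prop where
  meas : Measurable fun p : Param d × Z => ℓ p.1 p.2
  grad_meas : Measurable fun p : Param d × Z => sampleGrad ℓ p.2 p.1
  convex : Convex ℝ B
  compact : IsCompact B
  int : ∀ θ ∈ B, Integrable (ℓ θ) q
  diff : ∀ᵐ z ∂q, ∀ θ ∈ B, DifferentiableAt ℝ (fun ϑ => ℓ ϑ z) θ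
  bound : ∀ᵐ z ∂q, ∀ θ ∈ B, ‖sampleGrad ℓ z θ‖ ≤ L
  grad_lip : ∀ᵐ z ∂q, LipschitzOnWith K₁ (sampleGrad ℓ z) B
  diff2 : ∀ᵐ z ∂q, ∀ θ ∈ B, DifferentiableAt ℝ (sampleGrad ℓ z) θ
  hess_lip : ∀ᵐ z ∂q, LipschitzOnWith K₂ (sampleHess ℓ z) B

/-- The mean gradient `𝔼_{z ∼ q}[∇_θ ℓ(θ; z)]`. -/
noncomputable def meanGrad {d : ℕ} {Z : Type*} [MeasurableSpace Z] (ℓ : Param d → Z → ℝ)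
    (q : Measure Z) (θ : Param d) : Param d :=
  ∫ z, sampleGrad ℓ z θ ∂q

/-- The total variance of the sample gradient at `θ`. -/
noncomputable def gradVariance {d : ℕ} {Z : Type*} [MeasurableSpace Z] (ℓ : Param d → Z → ℝ)
    (q : Measure Z) (θ : Param d) : ℝ :=
  ∫ z, ‖sampleGrad ℓ z θ - meanGrad ℓ q θ‖ ^ 2 ∂q

/-- Stands in for differentiating the expected loss: a first-order expansion is divided by t and t
tends to 0 from the right. -/
theorem le_of_eventually_le_add_mul {X A b : ℝ} (h : ∀ᶠ t : ℝ in 𝓝[>] 0, X ≤ A + t * b) :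
    X ≤ A := by
  have ht : Tendsto (fun t : ℝ => A + t * b) (𝓝[>] 0) (𝓝 A) := by
    have : Tendsto (fun t : ℝ => A + t * b) (𝓝 0) (𝓝 (A + 0 * b)) :=
      (Continuous.tendsto (by fun_prop) 0)
    simpa using this.mono_left nhdsWithin_le_nhds
  exact ge_of_tendsto ht h

namespace RegularLoss

variable {d : ℕ} {Z : Type*} [MeasurableSpace Z] {ℓ : Param d → Z → ℝ} {q : Measure Z}
  {B : Set (Param d)} {L : ℝ} {K₁ K₂ : ℝ≥0}

theorem measurable_grad (h : RegularLoss ℓ q B L K₁ K₂) (θ : Param d) :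
    Measurable fun z => sampleGrad ℓ z θ :=
  h.grad_meas.comp (measurable_const.prodMk measurable_id)

theorem measurable_meanGrad [SFinite q] (h : RegularLoss ℓ q B L K₁ K₂) :
    Measurable (meanGrad ℓ q) :=
  (h.grad_meas.stronglyMeasurable.integral_prod_right' (ν := q)).measurable

theorem measurable_gradVariance [SFinite q] (h : RegularLoss ℓ q B L K₁ K₂) :
    Measurable (gradVariance ℓ q) := by
  have hm : Measurable fun p : Param d × Z => ‖sampleGrad ℓ p.2 p.1 - meanGrad ℓ q p.1‖ ^ 2 :=
    ((h.grad_meas.sub (h.measurable_meanGrad.comp measurable_fst)).norm).pow_const 2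
  exact (hm.stronglyMeasurable.integral_prod_right' (ν := q)).measurable

theorem bound_nonneg [IsProbabilityMeasure q] (h : RegularLoss ℓ q B L K₁ K₂) (hne : B.Nonempty) :
    0 ≤ L := by
  obtain ⟨θ, hθ⟩ := hne
  obtain ⟨z, hz⟩ := h.bound.exists
  exact (norm_nonneg _).trans (hz θ hθ)

theorem integrable_grad [IsFiniteMeasure q] (h : RegularLoss ℓ q B L K₁ K₂) {θ : Param d}
    (hθ : θ ∈ B) : Integrable (fun z => sampleGrad ℓ z θ) q :=
  Integrable.of_bound (h.measurable_grad θ).aestronglyMeasurable L (h.bound.mono fun _ hz => hz θ hθ)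

theorem norm_meanGrad_le [IsProbabilityMeasure q] (h : RegularLoss ℓ q B L K₁ K₂) {θ : Param d}
    (hθ : θ ∈ B) : ‖meanGrad ℓ q θ‖ ≤ L := by
  rw [meanGrad]
  simpa using norm_integral_le_of_norm_le_const (h.bound.mono fun _ hz => hz θ hθ)

theorem norm_meanGrad_sub_le [IsProbabilityMeasure q] (h : RegularLoss ℓ q B L K₁ K₂)
    {x y : Param d} (hx : x ∈ B) (hy : y ∈ B) :
    ‖meanGrad ℓ q y - meanGrad ℓ q x‖ ≤ K₁ * ‖y - x‖ := by
  rw [meanGrad, meanGrad, ← integral_sub (h.integrable_grad hy) (h.integrable_grad hx)]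
  simpa using norm_integral_le_of_norm_le_const (μ := q)
    (h.grad_lip.mono fun z hz => hz.norm_sub_le hy hx)

/-- Convexity turns the gradient bound into a Lipschitz bound. The null set is chosen before the
points, so the estimate applies at random points. -/
theorem ae_abs_sub_le (h : RegularLoss ℓ q B L K₁ K₂) :
    ∀ᵐ z ∂q, ∀ x ∈ B, ∀ y ∈ B, |ℓ y z - ℓ x z| ≤ L * ‖y - x‖ := by
  filter_upwards [h.diff, h.bound] with z hd hb x hx y hy
  exact h.convex.norm_image_sub_le_of_norm_fderiv_le (𝕜 := ℝ) (f := fun ϑ => ℓ ϑ z)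
    (fun w hw => hd w hw) (fun w hw => (norm_gradient_eq _ _).symm.trans_le (hb w hw)) hx hy

/-- Integrating the expansion of each sample loss identifies the mean gradient as the gradient of
the expected loss, with a quantitative remainder. -/
theorem abs_expectedLoss_sub_sub_le [IsProbabilityMeasure q] (h : RegularLoss ℓ q B L K₁ K₂)
    {x y : Param d} (hx : x ∈ B) (hy : y ∈ B) :
    |expectedLoss ℓ q y - expectedLoss ℓ q x - ⟪meanGrad ℓ q x, y - x⟫| ≤ K₁ * ‖y - x‖ ^ 2 := by
  have hi := h.integrable_grad hx
  have e : expectedLoss ℓ q y - expectedLoss ℓ q x - ⟪meanGrad ℓ q x, y - x⟫ =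
      ∫ z, (ℓ y z - ℓ x z - ⟪sampleGrad ℓ z x, y - x⟫) ∂q := by
    have hi2 : Integrable (fun z => ℓ y z - ℓ x z) q := (h.int y hy).sub (h.int x hx)
    rw [integral_sub hi2 (hi.inner_const _),
      integral_sub (h.int y hy) (h.int x hx)]
    congr 1
    rw [meanGrad, real_inner_comm, ← integral_inner hi]
    simp only [real_inner_comm]
  rw [e]
  have := norm_integral_le_of_norm_le_const (μ := q) (C := K₁ * ‖y - x‖ ^ 2)
    (f := fun z => ℓ y z - ℓ x z - ⟪sampleGrad ℓ z x, y - x⟫) (by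
      filter_upwards [h.diff, h.grad_lip] with z hd hl
      exact abs_sub_sub_inner_gradient_le h.convex hd hl hx hy)
  simpa using this

/-- The mean gradient vanishes at an interior local minimum of the expected loss. -/
theorem meanGrad_eq_zero [IsProbabilityMeasure q] (h : RegularLoss ℓ q B L K₁ K₂) {θs : Param d}
    (hθs : θs ∈ interior B) (hmin : IsLocalMin (expectedLoss ℓ q) θs) :
    meanGrad ℓ q θs = 0 := by
  have key : ⟪meanGrad ℓ q θs, meanGrad ℓ q θs⟫ ≤ 0 := by
    set v := meanGrad ℓ q θs with hv
    have hc : Tendsto (fun t : ℝ => θs - t • v) (𝓝[>] 0) (𝓝 θs) := by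
      have : Tendsto (fun t : ℝ => θs - t • v) (𝓝 0) (𝓝 (θs - (0 : ℝ) • v)) :=
        Continuous.tendsto (by fun_prop) 0
      simpa using this.mono_left nhdsWithin_le_nhds
    -- Moving from θs by -t v changes the loss by at most -t‖v‖² + t²K₁‖v‖², and this must be
    -- nonnegative at a local minimum.
    refine le_of_eventually_le_add_mul (b := K₁ * ‖v‖ ^ 2) ?_
    filter_upwards [hc.eventually hmin, hc.eventually (mem_interior_iff_mem_nhds.1 hθs),
      self_mem_nhdsWithin] with t h1 h2 (ht : 0 < t)
    have h3 := (abs_le.1 (h.abs_expectedLoss_sub_sub_le (interior_subset hθs) h2)).2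
    rw [sub_sub_cancel_left, inner_neg_right, inner_smul_right, norm_neg, norm_smul, mul_pow,
      Real.norm_eq_abs, sq_abs, ← hv] at h3
    have h4 : t * ⟪v, v⟫ ≤ t * (0 + t * (K₁ * ‖v‖ ^ 2)) := by linarith
    exact le_of_mul_le_mul_left h4 ht
  exact inner_self_eq_zero.1 (le_antisymm key real_inner_self_nonneg)

/-- Strong convexity bounds the mean gradient from below in the direction of the minimum. -/
theorem le_inner_meanGrad [IsProbabilityMeasure q] (h : RegularLoss ℓ q B L K₁ K₂) {θs : Param d}
    (hθs : θs ∈ interior B) (hmin : IsLocalMin (expectedLoss ℓ q) θs) {μ : ℝ} (hμ : 0 < μ)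
    (hsc : StrongConvexOn B μ (expectedLoss ℓ q)) {θ : Param d} (hθ : θ ∈ B) :
    μ / 2 * ‖θ - θs‖ ^ 2 ≤ ⟪θ - θs, meanGrad ℓ q θ⟫ := by
  have hs := interior_subset hθs
  have hcx : ConvexOn ℝ B (expectedLoss ℓ q) := hsc.convexOn fun r => by positivity
  have hglob : expectedLoss ℓ q θs ≤ expectedLoss ℓ q θ :=
    IsMinOn.of_isLocalMinOn_of_convexOn hs (hmin.on B) hcx hθ
  have key : ⟪meanGrad ℓ q θ, θs - θ⟫ ≤ -(μ / 2 * ‖θs - θ‖ ^ 2) := by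
    -- At θ + t(θs - θ), strong convexity bounds the loss from above and the expansion at θ bounds
    -- it from below. Only 𝓛(θs) ≤ 𝓛(θ) is used for the loss gap, which leaves the constant μ/2
    -- instead of μ.
    refine le_of_eventually_le_add_mul (b := (K₁ + μ / 2) * ‖θs - θ‖ ^ 2) ?_
    filter_upwards [Ioo_mem_nhdsGT (show (0 : ℝ) < 1 by norm_num)] with t ht
    have hconv := hsc.2 hθ hs (sub_nonneg.2 ht.2.le) ht.1.le (by ring)
    have hmem := hsc.1 hθ hs (sub_nonneg.2 ht.2.le) ht.1.le (by ring)
    have e : (1 - t) • θ + t • θs - θ = t • (θs - θ) := by module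
    have h3 := (abs_le.1 (h.abs_expectedLoss_sub_sub_le hθ hmem)).1
    rw [e, inner_smul_right, norm_smul, mul_pow, Real.norm_eq_abs, sq_abs] at h3
    simp only [smul_eq_mul, norm_sub_rev θ θs] at hconv
    have h4 : t * ⟪meanGrad ℓ q θ, θs - θ⟫ ≤
        t * (-(μ / 2 * ‖θs - θ‖ ^ 2) + t * ((K₁ + μ / 2) * ‖θs - θ‖ ^ 2)) := by
      have := mul_le_mul_of_nonneg_left hglob ht.1.le
      nlinarith
    exact le_of_mul_le_mul_left h4 ht.1
  rw [real_inner_comm, ← neg_sub θs θ, inner_neg_right, norm_neg]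
  linarith

/-- The mean gradient is, to first order, given by the mean Hessian. -/
theorem norm_meanGrad_sub_sub_meanHessian_le [IsProbabilityMeasure q]
    (h : RegularLoss ℓ q B L K₁ K₂) {θs θ : Param d} (hθs : θs ∈ interior B) (hθ : θ ∈ B) :
    ‖meanGrad ℓ q θ - meanGrad ℓ q θs -
      Matrix.toEuclideanLin (meanHessian ℓ q θs) (θ - θs)‖ ≤ K₂ * ‖θ - θs‖ ^ 2 := by
  have hs := interior_subset hθs
  have hint : ∀ v, Integrable (fun z => sampleHess ℓ z θs v) q := by
    intro v
    refine Integrable.of_bound ?_ (K₁ * ‖v‖) ?_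
    -- The Hessian is measurable in z as a limit of difference quotients of the gradient with
    -- increments v/n.
    · refine aestronglyMeasurable_of_tendsto_ae (u := atTop) (ι := ℕ)
        (f := fun n z => (n : ℝ) • (sampleGrad ℓ z (θs + (n : ℝ)⁻¹ • v) - sampleGrad ℓ z θs))
        (fun n => (((h.measurable_grad _).sub (h.measurable_grad _)).const_smul
          (n : ℝ)).aestronglyMeasurable) ?_
      filter_upwards [h.diff2] with z hz
      refine (hz θs hs).hasFDerivAt.lim v ?_
      simpa using tendsto_natCast_atTop_atTop (R := ℝ)
    · filter_upwards [h.grad_lip] with z hz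
      refine (ContinuousLinearMap.le_opNorm _ _).trans ?_
      gcongr
      -- A Lipschitz bound on B controls the derivative at points having a neighbourhood in B, hence
      -- the interior hypothesis on θs.
      exact norm_fderiv_le_of_lipschitzOn ℝ (mem_interior_iff_mem_nhds.1 hθs) hz
  have hH : ∀ v, ∫ z, sampleHess ℓ z θs v ∂q = Matrix.toEuclideanLin (meanHessian ℓ q θs) v := by
    intro v
    ext i
    have hv : v = ∑ j, v j • EuclideanSpace.single j (1 : ℝ) := by
      ext i; simp [Pi.single_apply]
    have hproj : ∀ w, (∫ z, sampleHess ℓ z θs w ∂q) i = ∫ z, (sampleHess ℓ z θs w) i ∂q :=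
      fun w => ((EuclideanSpace.proj (𝕜 := ℝ) i).integral_comp_comm (hint w)).symm
    rw [hproj]
    calc ∫ z, (sampleHess ℓ z θs v) i ∂q
        = ∫ z, ∑ j, v j * (sampleHess ℓ z θs (EuclideanSpace.single j 1)) i ∂q := by
          congr 1 with z
          conv_lhs => rw [hv, map_sum]
          simp
      _ = ∑ j, v j * ∫ z, (sampleHess ℓ z θs (EuclideanSpace.single j 1)) i ∂q := by
          rw [integral_finsetSum]
          · simp_rw [integral_const_mul]
          · intro j _
            exact ((EuclideanSpace.proj (𝕜 := ℝ) i).integrable_comp (hint _)).const_mul _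
      _ = _ := by
          simp [Matrix.toLpLin_apply, Matrix.mulVec, dotProduct, meanHessian, mul_comm]
  have hi2 : Integrable (fun z => sampleGrad ℓ z θ - sampleGrad ℓ z θs) q :=
    (h.integrable_grad hθ).sub (h.integrable_grad hs)
  rw [← hH, meanGrad, meanGrad, ← integral_sub (h.integrable_grad hθ) (h.integrable_grad hs),
    ← integral_sub hi2 (hint _)]
  have := norm_integral_le_of_norm_le_const (μ := q) (C := K₂ * ‖θ - θs‖ ^ 2)
    (f := fun z => sampleGrad ℓ z θ - sampleGrad ℓ z θs - sampleHess ℓ z θs (θ - θs)) (by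
      filter_upwards [h.diff2, h.hess_lip] with z hd hl
      exact norm_sub_sub_fderiv_le h.convex hd hl hs hθ)
  simpa using this

theorem integrable_norm_grad_sub_sq [IsProbabilityMeasure q] (h : RegularLoss ℓ q B L K₁ K₂)
    {θ : Param d} (hθ : θ ∈ B) :
    Integrable (fun z => ‖sampleGrad ℓ z θ - meanGrad ℓ q θ‖ ^ 2) q := by
  refine Integrable.of_bound
    ((((h.measurable_grad θ).sub_const _).norm).pow_const 2).aestronglyMeasurable ((2 * L) ^ 2) ?_
  filter_upwards [h.bound] with z hz
  rw [norm_pow, norm_norm]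
  gcongr
  linarith [norm_sub_le (sampleGrad ℓ z θ) (meanGrad ℓ q θ), hz θ hθ, h.norm_meanGrad_le hθ]

/-- The constant comes from ‖a‖² - ‖b‖² = (‖a‖ - ‖b‖)(‖a‖ + ‖b‖) for the centred gradients: the
first factor is at most 2K₁‖y - x‖, the second at most 4L. -/
theorem gradVariance_le_add [IsProbabilityMeasure q] (h : RegularLoss ℓ q B L K₁ K₂)
    {x y : Param d} (hx : x ∈ B) (hy : y ∈ B) :
    gradVariance ℓ q y ≤ gradVariance ℓ q x + 8 * L * K₁ * ‖y - x‖ := by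
  have hL := h.bound_nonneg ⟨x, hx⟩
  have e : gradVariance ℓ q x + 8 * L * K₁ * ‖y - x‖ =
      ∫ z, (‖sampleGrad ℓ z x - meanGrad ℓ q x‖ ^ 2 + 8 * L * K₁ * ‖y - x‖) ∂q := by
    rw [integral_add (h.integrable_norm_grad_sub_sq hx) (integrable_const _)]
    simp [gradVariance]
  rw [e]
  refine integral_mono_ae (h.integrable_norm_grad_sub_sq hy)
    ((h.integrable_norm_grad_sub_sq hx).add (integrable_const _)) ?_
  filter_upwards [h.bound, h.grad_lip] with z hb hl
  have h1 := hl.norm_sub_le hy hx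
  have h2 := h.norm_meanGrad_sub_le hx hy
  set a := sampleGrad ℓ z y - meanGrad ℓ q y with ha
  set b := sampleGrad ℓ z x - meanGrad ℓ q x with hb'
  have h3 : ‖a‖ ≤ 2 * L := by
    linarith [norm_sub_le (sampleGrad ℓ z y) (meanGrad ℓ q y), hb y hy, h.norm_meanGrad_le hy]
  have h4 : ‖b‖ ≤ 2 * L := by
    linarith [norm_sub_le (sampleGrad ℓ z x) (meanGrad ℓ q x), hb x hx, h.norm_meanGrad_le hx]
  have h5 : ‖a‖ - ‖b‖ ≤ 2 * K₁ * ‖y - x‖ := by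
    have h6 : a - b = (sampleGrad ℓ z y - sampleGrad ℓ z x) -
        (meanGrad ℓ q y - meanGrad ℓ q x) := by rw [ha, hb']; abel
    have h7 := norm_sub_norm_le a b
    rw [h6] at h7
    linarith [norm_sub_le (sampleGrad ℓ z y - sampleGrad ℓ z x)
      (meanGrad ℓ q y - meanGrad ℓ q x)]
  have h8 : (‖a‖ - ‖b‖) * (‖a‖ + ‖b‖) ≤ (2 * K₁ * ‖y - x‖) * (4 * L) :=
    mul_le_mul h5 (by linarith) (by positivity) (by positivity)
  nlinarith

theorem gradVariance_eq_trace [IsProbabilityMeasure q] (h : RegularLoss ℓ q B L K₁ K₂)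
    {θ : Param d} (hθ : θ ∈ B) : gradVariance ℓ q θ = (gradCovariance ℓ q θ).trace := by
  have hi := h.integrable_grad hθ
  have hproj : ∀ i, meanGrad ℓ q θ i = ∫ z, sampleGrad ℓ z θ i ∂q :=
    fun i => ((EuclideanSpace.proj (𝕜 := ℝ) i).integral_comp_comm hi).symm
  simp only [gradVariance, Matrix.trace, Matrix.diag, gradCovariance, Matrix.of_apply, covariance,
    EuclideanSpace.real_norm_sq_eq, ← hproj, PiLp.sub_apply, ← sq]
  rw [integral_finsetSum]
  intro i _
  refine Integrable.mono' (h.integrable_norm_grad_sub_sq hθ) ?_ (Eventually.of_forall fun z => ?_)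
  · exact (((((EuclideanSpace.proj (𝕜 := ℝ) i).continuous.measurable.comp
      (h.measurable_grad θ)).sub_const _)).pow_const 2).aestronglyMeasurable
  · rw [Real.norm_of_nonneg (sq_nonneg _), EuclideanSpace.real_norm_sq_eq]
    exact Finset.single_le_sum
      (f := fun i => (sampleGrad ℓ z θ - meanGrad ℓ q θ) i ^ 2) (fun _ _ => sq_nonneg _)
      (Finset.mem_univ i)

end RegularLoss

/-! ### Mini-batches independent of the past. -/

/-- Freezing: if `Y` is independent of the `m`-measurable `X`, the expectation of `f (X, Y)` can be
computed by integrating over `Y` first, with `X` held fixed. -/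
theorem integral_eq_integral_integral_of_indep {Ω E S : Type*} {m : MeasurableSpace Ω}
    [mΩ : MeasurableSpace Ω] [MeasurableSpace E] [MeasurableSpace S] {P : Measure Ω}
    [IsProbabilityMeasure P] (hm : m ≤ mΩ) {X : Ω → E} {Y : Ω → S} (hX : Measurable[m] X)
    (hY : Measurable Y) (hind : Indep (MeasurableSpace.comap Y inferInstance) m P)
    {f : E × S → ℝ} (hf : Measurable f) (hint : Integrable (fun ω => f (X ω, Y ω)) P) :
    ∫ ω, f (X ω, Y ω) ∂P = ∫ ω, ∫ ω', f (X ω, Y ω') ∂P ∂P := by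
  have hX' : Measurable X := hX.mono hm le_rfl
  have hXY : IndepFun X Y P := (indep_of_indep_of_le_right hind hX.comap_le).symm
  have hprod := (indepFun_iff_map_prod_eq_prod_map_map hX'.aemeasurable hY.aemeasurable).1 hXY
  have hmeas : Measurable fun ω => (X ω, Y ω) := hX'.prodMk hY
  have := Measure.isProbabilityMeasure_map (μ := P) hX'.aemeasurable
  have := Measure.isProbabilityMeasure_map (μ := P) hY.aemeasurable
  have hint' : Integrable f ((P.map X).prod (P.map Y)) := by
    rw [← hprod]
    exact (integrable_map_measure hf.aestronglyMeasurable hmeas.aemeasurable).2 hint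
  rw [← integral_map (f := f) hmeas.aemeasurable hf.aestronglyMeasurable, hprod,
    integral_prod _ hint', integral_map hX'.aemeasurable]
  · congr 1 with ω
    rw [integral_map hY.aemeasurable]
    exact (hf.comp (measurable_const.prodMk measurable_id)).aestronglyMeasurable
  · exact (hf.stronglyMeasurable.integral_prod_right' (ν := P.map Y)).aestronglyMeasurable

/-- A nonempty batch of samples with law `q`, independent of the past `m`. -/
structure FreshBatch {Ω Z : Type*} (m : MeasurableSpace Ω) [MeasurableSpace Ω]
    [MeasurableSpace Z] (P : Measure Ω) (q : Measure Z) {n : ℕ} (Y : Ω → Fin n → Z) : Prop where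
  pos : 0 < n
  meas : Measurable Y
  law : ∀ j, P.map (fun ω => Y ω j) = q
  indep : Indep (MeasurableSpace.comap Y inferInstance) m P

theorem RegularLoss.measurable_batchGrad {d : ℕ} {Z β : Type*} [MeasurableSpace Z]
    {mβ : MeasurableSpace β} {ℓ : Param d → Z → ℝ} {q : Measure Z} {B : Set (Param d)} {L : ℝ}
    {K₁ K₂ : ℝ≥0} (h : RegularLoss ℓ q B L K₁ K₂) {n : ℕ} {t : β → Param d} {Y : β → Fin n → Z}
    (ht : Measurable t) (hY : Measurable Y) :
    Measurable fun x => batchGrad ℓ (Y x) (t x) := by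
  have hs : Measurable fun x => ∑ j, sampleGrad ℓ (Y x j) (t x) :=
    Finset.measurable_fun_sum _ fun j _ => h.grad_meas.comp
      (ht.prodMk ((measurable_pi_apply j).comp hY))
  exact hs.const_smul (n : ℝ)⁻¹

namespace FreshBatch

variable {d : ℕ} {Ω Z : Type*} {m : MeasurableSpace Ω} [mΩ : MeasurableSpace Ω]
  [MeasurableSpace Z] {P : Measure Ω} {q : Measure Z} {n : ℕ} {Y : Ω → Fin n → Z}
  {ℓ : Param d → Z → ℝ} {B : Set (Param d)} {L : ℝ} {K₁ K₂ : ℝ≥0}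

theorem measurable_apply (hY : FreshBatch m P q Y) (j : Fin n) : Measurable fun ω => Y ω j :=
  (measurable_pi_apply j).comp hY.meas

theorem ae_forall (hY : FreshBatch m P q Y) {p : Z → Prop} (hp : ∀ᵐ z ∂q, p z) :
    ∀ᵐ ω ∂P, ∀ j, p (Y ω j) := by
  refine ae_all_iff.2 fun j => ?_
  rw [← hY.law j] at hp
  exact ae_of_ae_map (hY.measurable_apply j).aemeasurable hp

theorem ae_norm_batchGrad_le (hY : FreshBatch m P q Y) (h : RegularLoss ℓ q B L K₁ K₂) :
    ∀ᵐ ω ∂P, ∀ θ ∈ B, ‖batchGrad ℓ (Y ω) θ‖ ≤ L := by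
  filter_upwards [hY.ae_forall h.bound] with ω hω θ hθ
  have hn : (0 : ℝ) < n := Nat.cast_pos.2 hY.pos
  rw [batchGrad, norm_smul, norm_inv, Real.norm_natCast, inv_mul_le_iff₀ hn]
  refine (norm_sum_le _ _).trans ((Finset.sum_le_sum fun j _ => hω j θ hθ).trans_eq ?_)
  simp

theorem integrable_sampleGrad (hY : FreshBatch m P q Y) [IsFiniteMeasure q]
    (h : RegularLoss ℓ q B L K₁ K₂) {θ : Param d} (hθ : θ ∈ B) (j : Fin n) :
    Integrable (fun ω => sampleGrad ℓ (Y ω j) θ) P := by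
  have hi := h.integrable_grad hθ
  rw [← hY.law j] at hi
  exact (integrable_map_measure (h.measurable_grad θ).aestronglyMeasurable
    (hY.measurable_apply j).aemeasurable).1 hi

theorem integral_batchGrad (hY : FreshBatch m P q Y) [IsFiniteMeasure q]
    (h : RegularLoss ℓ q B L K₁ K₂) {θ : Param d} (hθ : θ ∈ B) :
    ∫ ω, batchGrad ℓ (Y ω) θ ∂P = meanGrad ℓ q θ := by
  have hn : (n : ℝ) ≠ 0 := (Nat.cast_pos.2 hY.pos).ne'
  have hj : ∀ j, ∫ ω, sampleGrad ℓ (Y ω j) θ ∂P = meanGrad ℓ q θ := fun j => by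
    rw [meanGrad, ← hY.law j, integral_map (hY.measurable_apply j).aemeasurable
      (h.measurable_grad θ).aestronglyMeasurable]
  simp only [batchGrad]
  rw [integral_smul, integral_finsetSum _ fun j _ => hY.integrable_sampleGrad h hθ j]
  simp only [hj, Finset.sum_const, Finset.card_univ, Fintype.card_fin]
  rw [← Nat.cast_smul_eq_nsmul ℝ, smul_smul, inv_mul_cancel₀ hn, one_smul]

theorem integrable_batchGrad (hY : FreshBatch m P q Y) [IsFiniteMeasure q]
    (h : RegularLoss ℓ q B L K₁ K₂) {θ : Param d} (hθ : θ ∈ B) :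
    Integrable (fun ω => batchGrad ℓ (Y ω) θ) P := by
  have hs : Integrable (fun ω => ∑ j, sampleGrad ℓ (Y ω j) θ) P :=
    integrable_finsetSum _ fun j _ => hY.integrable_sampleGrad h hθ j
  exact hs.smul (n : ℝ)⁻¹

/-- Cauchy–Schwarz over the batch. The samples of one batch may depend on each other, so averaging
is not claimed to reduce the variance. -/
theorem integral_norm_batchGrad_sub_sq_le (hY : FreshBatch m P q Y) [IsProbabilityMeasure q]
    (h : RegularLoss ℓ q B L K₁ K₂) {θ : Param d} (hθ : θ ∈ B) :
    ∫ ω, ‖batchGrad ℓ (Y ω) θ - meanGrad ℓ q θ‖ ^ 2 ∂P ≤ gradVariance ℓ q θ := by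
  have hn : (0 : ℝ) < n := Nat.cast_pos.2 hY.pos
  set f : Z → ℝ := fun z => ‖sampleGrad ℓ z θ - meanGrad ℓ q θ‖ ^ 2 with hf
  have hfm : Measurable f := (((h.measurable_grad θ).sub_const _).norm).pow_const 2
  have hj : ∀ j, ∫ ω, f (Y ω j) ∂P = gradVariance ℓ q θ := fun j => by
    rw [gradVariance, ← hY.law j, integral_map (hY.measurable_apply j).aemeasurable]
    · rw [hY.law j]
    · rw [hY.law j]
      exact hfm.aestronglyMeasurable
  have hji : ∀ j, Integrable (fun ω => f (Y ω j)) P := fun j => by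
    have hi := h.integrable_norm_grad_sub_sq hθ
    rw [← hY.law j] at hi
    refine (integrable_map_measure (f := fun ω => Y ω j) (g := f) hfm.aestronglyMeasurable
      (hY.measurable_apply j).aemeasurable).1 ?_
    rwa [hY.law j] at hi ⊢
  have hpt : ∀ ω, ‖batchGrad ℓ (Y ω) θ - meanGrad ℓ q θ‖ ^ 2 ≤ (n : ℝ)⁻¹ * ∑ j, f (Y ω j) := by
    intro ω
    have e : batchGrad ℓ (Y ω) θ - meanGrad ℓ q θ =
        (n : ℝ)⁻¹ • ∑ j, (sampleGrad ℓ (Y ω j) θ - meanGrad ℓ q θ) := by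
      rw [batchGrad, Finset.sum_sub_distrib, smul_sub]
      simp only [Finset.sum_const, Finset.card_univ, Fintype.card_fin]
      rw [← Nat.cast_smul_eq_nsmul ℝ, smul_smul, inv_mul_cancel₀ hn.ne', one_smul]
    rw [e, norm_smul, mul_pow, norm_inv, Real.norm_natCast]
    have h1 : ‖∑ j, (sampleGrad ℓ (Y ω j) θ - meanGrad ℓ q θ)‖ ^ 2 ≤ n * ∑ j, f (Y ω j) := by
      calc _ ≤ (∑ j, ‖sampleGrad ℓ (Y ω j) θ - meanGrad ℓ q θ‖) ^ 2 := by
            gcongr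
            exact norm_sum_le _ _
        _ ≤ _ := by
            have := sq_sum_le_card_mul_sum_sq (s := Finset.univ)
              (f := fun j => ‖sampleGrad ℓ (Y ω j) θ - meanGrad ℓ q θ‖)
            simpa using this
    calc (n : ℝ)⁻¹ ^ 2 * ‖∑ j, (sampleGrad ℓ (Y ω j) θ - meanGrad ℓ q θ)‖ ^ 2
        ≤ (n : ℝ)⁻¹ ^ 2 * (n * ∑ j, f (Y ω j)) := by gcongr
      _ = _ := by field_simp
  have hI : Integrable (fun ω => (n : ℝ)⁻¹ * ∑ j, f (Y ω j)) P :=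
    (integrable_finsetSum _ fun j _ => hji j).const_mul _
  calc _ ≤ ∫ ω, (n : ℝ)⁻¹ * ∑ j, f (Y ω j) ∂P :=
        integral_mono_of_nonneg (Eventually.of_forall fun ω => by positivity) hI
          (Eventually.of_forall hpt)
    _ = gradVariance ℓ q θ := by
        rw [integral_const_mul, integral_finsetSum _ fun j _ => hji j]
        simp only [hj, Finset.sum_const, Finset.card_univ, Fintype.card_fin, nsmul_eq_mul]
        field_simp

/-- The batch gradient at an `m`-measurable point of `B` has the mean gradient as its conditional
expectation, tested against a bounded `m`-measurable vector. -/
theorem setIntegral_inner_batchGrad [IsProbabilityMeasure P] (hY : FreshBatch m P q Y)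
    [IsFiniteMeasure q] (h : RegularLoss ℓ q B L K₁ K₂) (hm : m ≤ mΩ) {A : Set Ω}
    (hA : MeasurableSet[m] A) {t V : Ω → Param d} (ht : Measurable[m] t) (hV : Measurable[m] V)
    (htB : ∀ ω ∈ A, t ω ∈ B) {M : ℝ} (hM : ∀ᵐ ω ∂P, ω ∈ A → ‖V ω‖ ≤ M) :
    ∫ ω in A, ⟪V ω, batchGrad ℓ (Y ω) (t ω)⟫ ∂P = ∫ ω in A, ⟪V ω, meanGrad ℓ q (t ω)⟫ ∂P := by
  set f : (Param d × Param d) × (Fin n → Z) → ℝ := fun p => ⟪p.1.1, batchGrad ℓ p.2 p.1.2⟫ with hf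
  -- Off A the point t may leave B, where no bound on the gradient is available. Moving the
  -- indicator into V makes the integrand vanish there and keeps it a function of `m`-measurable
  -- data and the batch.
  set W := A.indicator V with hW
  have hWm : Measurable[m] W := hV.indicator hA
  have hbm : Measurable fun p : (Param d × Param d) × (Fin n → Z) => batchGrad ℓ p.2 p.1.2 :=
    h.measurable_batchGrad measurable_fst.snd measurable_snd
  have ham : Measurable fun p : (Param d × Param d) × (Fin n → Z) => p.1.1 := measurable_fst.fst
  have hfm : Measurable f := ham.inner (𝕜 := ℝ) hbm
  have hXm : Measurable[m] fun ω => (W ω, t ω) := hWm.prodMk ht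
  have e1 : A.indicator (fun ω => ⟪V ω, batchGrad ℓ (Y ω) (t ω)⟫) =
      fun ω => f ((W ω, t ω), Y ω) := by
    ext ω
    by_cases hω : ω ∈ A <;> simp [hf, hW, hω]
  have hint : Integrable (fun ω => f ((W ω, t ω), Y ω)) P := by
    refine Integrable.of_bound (hfm.comp ((hXm.mono hm le_rfl).prodMk hY.meas)).aestronglyMeasurable
      (|M * L|) ?_
    filter_upwards [hM, hY.ae_norm_batchGrad_le h] with ω h1 h2
    by_cases hω : ω ∈ A
    · have h3 : f ((W ω, t ω), Y ω) = ⟪V ω, batchGrad ℓ (Y ω) (t ω)⟫ := by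
        simp only [hf, hW, indicator_of_mem hω]
      have h4 := mul_le_mul (h1 hω) (h2 _ (htB ω hω)) (norm_nonneg _)
        ((norm_nonneg _).trans (h1 hω))
      rw [h3]
      exact (norm_inner_le_norm _ _).trans (h4.trans (le_abs_self _))
    · simp only [hf, hW, indicator_of_notMem hω, inner_zero_left, norm_zero]
      positivity
  rw [← integral_indicator (hm _ hA), e1,
    integral_eq_integral_integral_of_indep hm hXm hY.meas hY.indep hfm hint,
    ← integral_indicator (hm _ hA)]
  congr 1 with ω
  by_cases hω : ω ∈ A
  · simp only [hf, hW, indicator_of_mem hω]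
    rw [integral_inner (hY.integrable_batchGrad h (htB ω hω)), hY.integral_batchGrad h (htB ω hω)]
  · simp [hf, hW, hω]

/-- Freezing again, now with the indicator of A as a scalar weight: given the past, the batch noise
has at most the variance of one sample. -/
theorem setIntegral_norm_batchGrad_sub_sq_le [IsProbabilityMeasure P] (hY : FreshBatch m P q Y)
    [IsProbabilityMeasure q] (h : RegularLoss ℓ q B L K₁ K₂) (hm : m ≤ mΩ) {A : Set Ω}
    (hA : MeasurableSet[m] A) {t : Ω → Param d} (ht : Measurable[m] t)
    (htB : ∀ ω ∈ A, t ω ∈ B) (hTi : IntegrableOn (fun ω => gradVariance ℓ q (t ω)) A P) :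
    ∫ ω in A, ‖batchGrad ℓ (Y ω) (t ω) - meanGrad ℓ q (t ω)‖ ^ 2 ∂P ≤
      ∫ ω in A, gradVariance ℓ q (t ω) ∂P := by
  set f : (ℝ × Param d) × (Fin n → Z) → ℝ :=
    fun p => p.1.1 * ‖batchGrad ℓ p.2 p.1.2 - meanGrad ℓ q p.1.2‖ ^ 2 with hf
  set W : Ω → ℝ := A.indicator 1 with hW
  have hWm : Measurable[m] W := (measurable_const (a := (1 : ℝ))).indicator hA
  have hfm : Measurable f := (measurable_fst.comp measurable_fst).mul
    (((h.measurable_batchGrad measurable_fst.snd measurable_snd).sub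
        (h.measurable_meanGrad.comp (measurable_snd.comp measurable_fst))).norm.pow_const 2)
  have hXm : Measurable[m] fun ω => (W ω, t ω) := hWm.prodMk ht
  have e1 : A.indicator (fun ω => ‖batchGrad ℓ (Y ω) (t ω) - meanGrad ℓ q (t ω)‖ ^ 2) =
      fun ω => f ((W ω, t ω), Y ω) := by
    ext ω
    by_cases hω : ω ∈ A <;> simp [hf, hW, hω]
  have hint : Integrable (fun ω => f ((W ω, t ω), Y ω)) P := by
    refine Integrable.of_bound (hfm.comp ((hXm.mono hm le_rfl).prodMk hY.meas)).aestronglyMeasurable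
      ((L + L) ^ 2) ?_
    filter_upwards [hY.ae_norm_batchGrad_le h] with ω h2
    by_cases hω : ω ∈ A
    · simp only [hf, hW, indicator_of_mem hω, Pi.one_apply, one_mul, norm_pow, norm_norm]
      gcongr
      exact (norm_sub_le _ _).trans (add_le_add (h2 _ (htB ω hω)) (h.norm_meanGrad_le (htB ω hω)))
    · simp only [hf, hW, indicator_of_notMem hω, zero_mul, norm_zero]
      positivity
  rw [← integral_indicator (hm _ hA), e1,
    integral_eq_integral_integral_of_indep hm hXm hY.meas hY.indep hfm hint,
    ← integral_indicator (hm _ hA)]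
  refine integral_mono_of_nonneg (Eventually.of_forall fun ω => integral_nonneg fun ω' => ?_)
    (hTi.integrable_indicator (hm _ hA)) (Eventually.of_forall fun ω => ?_)
  · by_cases hω : ω ∈ A
    · simp only [hf, hW, indicator_of_mem hω, Pi.one_apply, one_mul, Pi.zero_apply]
      positivity
    · simp [hf, hW, hω]
  · by_cases hω : ω ∈ A
    · simp only [hf, hW, indicator_of_mem hω, Pi.one_apply, one_mul]
      exact hY.integral_norm_batchGrad_sub_sq_le h (htB ω hω)
    · simp [hf, hW, hω]

end FreshBatch

/-! ### Moments of the distance to the minimum along a run. -/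

/-- A run `θ` of SGD with step sizes `η` and mini-batches `D`, adapted to `ℱ`, with fresh batches. -/
structure SGDRun {d : ℕ} {Ω Z : Type*} [mΩ : MeasurableSpace Ω] [MeasurableSpace Z]
    (ℓ : Param d → Z → ℝ) (q : Measure Z) (P : Measure Ω) (ℱ : Filtration ℕ mΩ) (η : ℕ → ℝ)
    {b : ℕ → ℕ} (D : (k : ℕ) → Ω → Fin (b k) → Z) (θ : ℕ → Ω → Param d) : Prop where
  step : ∀ k ω, θ (k + 1) ω = θ k ω - η k • batchGrad ℓ (D k ω) (θ k ω)
  meas : ∀ k, Measurable[ℱ k] (θ k)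
  batch_meas : ∀ k, Measurable[ℱ (k + 1)] (D k)
  fresh : ∀ k, FreshBatch (ℱ k) P q (D k)

theorem integrableOn_of_ae_bound {Ω E : Type*} [MeasurableSpace Ω] [NormedAddCommGroup E]
    {P : Measure Ω} [IsFiniteMeasure P] {A : Set Ω} (hA : MeasurableSet A) {f : Ω → E}
    (hf : AEStronglyMeasurable f P) {C : ℝ} (hC : ∀ᵐ ω ∂P, ω ∈ A → ‖f ω‖ ≤ C) :
    IntegrableOn f A P :=
  Integrable.of_bound hf.restrict C ((ae_restrict_iff' hA).2 hC)

theorem stayIn_anti {d : ℕ} {Ω : Type*} {B : Set (Param d)} {θ : ℕ → Ω → Param d} :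
    Antitone (stayIn B θ) :=
  fun _ _ hkl _ hω i hi => hω i (hi.trans hkl)

theorem setIntegral_le_setIntegral_of_subset {Ω : Type*} [MeasurableSpace Ω] {P : Measure Ω}
    {s t : Set Ω} (hst : s ⊆ t) {f : Ω → ℝ} (hf : ∀ ω, 0 ≤ f ω) (hi : IntegrableOn f t P) :
    ∫ ω in s, f ω ∂P ≤ ∫ ω in t, f ω ∂P :=
  setIntegral_mono_set hi (Eventually.of_forall hf) hst.eventuallyLE

/-- Jensen's inequality for the square, on a measure of mass at most one. -/
theorem integral_le_sqrt_integral_sq {Ω : Type*} [MeasurableSpace Ω] {ν : Measure Ω}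
    [IsFiniteMeasure ν] (hν : ν.real univ ≤ 1) {f : Ω → ℝ} (hf : Integrable f ν)
    (hf2 : Integrable (fun ω => f ω ^ 2) ν) : ∫ ω, f ω ∂ν ≤ √(∫ ω, f ω ^ 2 ∂ν) := by
  set a := ∫ ω, f ω ∂ν with ha
  refine Real.le_sqrt_of_sq_le ?_
  have h : 0 ≤ ∫ ω, (f ω - a) ^ 2 ∂ν := integral_nonneg fun ω => sq_nonneg _
  have e : ∀ ω, (f ω - a) ^ 2 = f ω ^ 2 - 2 * a * f ω + a ^ 2 := fun ω => by ring
  have h1 : Integrable (fun ω => 2 * a * f ω) ν := hf.const_mul _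
  have h2 : Integrable (fun ω => f ω ^ 2 - 2 * a * f ω) ν := hf2.sub h1
  simp_rw [e] at h
  rw [integral_add h2 (integrable_const _), integral_sub hf2 h1, integral_const_mul, ← ha,
    integral_const, smul_eq_mul] at h
  nlinarith [sq_nonneg a]

namespace SGDRun

variable {d : ℕ} {Ω Z : Type*} [mΩ : MeasurableSpace Ω] [MeasurableSpace Z]
  {ℓ : Param d → Z → ℝ} {q : Measure Z} {P : Measure Ω} {ℱ : Filtration ℕ mΩ} {η : ℕ → ℝ}
  {b : ℕ → ℕ} {D : (k : ℕ) → Ω → Fin (b k) → Z} {θ : ℕ → Ω → Param d}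
  {B : Set (Param d)} {L : ℝ} {K₁ K₂ : ℝ≥0}

theorem measurableSet_stayIn (hR : SGDRun ℓ q P ℱ η D θ) (h : RegularLoss ℓ q B L K₁ K₂) (k : ℕ) :
    MeasurableSet[ℱ k] (stayIn B θ k) := by
  have e : stayIn B θ k = ⋂ i ∈ Iic k, θ i ⁻¹' B := by
    ext ω; simp [stayIn]
  rw [e]
  exact MeasurableSet.biInter (to_countable _) fun i hi =>
    ℱ.mono hi _ (hR.meas i h.compact.measurableSet)

theorem measurableSet_stayIn' (hR : SGDRun ℓ q P ℱ η D θ) (h : RegularLoss ℓ q B L K₁ K₂)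
    (k : ℕ) : MeasurableSet (stayIn B θ k) :=
  ℱ.le k _ (hR.measurableSet_stayIn h k)

theorem measurable (hR : SGDRun ℓ q P ℱ η D θ) (k : ℕ) : Measurable (θ k) :=
  (hR.meas k).mono (ℱ.le k) le_rfl

theorem measurable_batchGrad (hR : SGDRun ℓ q P ℱ η D θ) (h : RegularLoss ℓ q B L K₁ K₂) (k : ℕ) :
    Measurable[ℱ (k + 1)] fun ω => batchGrad ℓ (D k ω) (θ k ω) :=
  h.measurable_batchGrad ((hR.meas k).mono (ℱ.mono k.le_succ) le_rfl) (hR.batch_meas k)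

theorem measurable_batchGrad' (hR : SGDRun ℓ q P ℱ η D θ) (h : RegularLoss ℓ q B L K₁ K₂)
    (k : ℕ) : Measurable fun ω => batchGrad ℓ (D k ω) (θ k ω) :=
  (hR.measurable_batchGrad h k).mono (ℱ.le _) le_rfl

theorem ae_norm_batchGrad_le (hR : SGDRun ℓ q P ℱ η D θ) (h : RegularLoss ℓ q B L K₁ K₂) :
    ∀ᵐ ω ∂P, ∀ k, θ k ω ∈ B → ‖batchGrad ℓ (D k ω) (θ k ω)‖ ≤ L :=
  ae_all_iff.2 fun k => ((hR.fresh k).ae_norm_batchGrad_le h).mono fun _ hω hk => hω _ hk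

theorem exists_radius (h : RegularLoss ℓ q B L K₁ K₂) (θs : Param d) :
    ∃ R, ∀ x ∈ B, ‖x - θs‖ ≤ R := by
  obtain ⟨R, hR⟩ := h.compact.isBounded.exists_norm_le
  exact ⟨R + ‖θs‖, fun x hx => (norm_sub_le _ _).trans (by gcongr; exact hR x hx)⟩

theorem norm_next_sq (hR : SGDRun ℓ q P ℱ η D θ) (θs : Param d) (k : ℕ) (ω : Ω) :
    ‖θ (k + 1) ω - θs‖ ^ 2 = ‖θ k ω - θs‖ ^ 2 -
      2 * η k * ⟪θ k ω - θs, batchGrad ℓ (D k ω) (θ k ω)⟫ +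
        η k ^ 2 * ‖batchGrad ℓ (D k ω) (θ k ω)‖ ^ 2 := by
  rw [hR.step, sub_right_comm, norm_sub_sq_real, inner_smul_right, norm_smul, mul_pow,
    Real.norm_eq_abs, sq_abs]
  ring

section Moments

variable [IsProbabilityMeasure P] {θs : Param d}

theorem integrableOn_norm_pow (hR : SGDRun ℓ q P ℱ η D θ) (h : RegularLoss ℓ q B L K₁ K₂)
    (θs : Param d) {i k : ℕ} (hik : i ≤ k) (p : ℕ) :
    IntegrableOn (fun ω => ‖θ i ω - θs‖ ^ p) (stayIn B θ k) P := by
  obtain ⟨R, hRad⟩ := exists_radius h θs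
  refine integrableOn_of_ae_bound (hR.measurableSet_stayIn' h k)
    (((hR.measurable i).sub_const θs).norm.pow_const p).aestronglyMeasurable (C := R ^ p)
    (Eventually.of_forall fun ω hω => ?_)
  rw [norm_pow, norm_norm]
  gcongr
  exact hRad _ (hω i hik)

/-- On the event up to time k the next iterate may leave B, but by at most one step of length |η_k|
L. -/
theorem integrableOn_norm_next_pow (hR : SGDRun ℓ q P ℱ η D θ) (h : RegularLoss ℓ q B L K₁ K₂)
    (θs : Param d) (k p : ℕ) :
    IntegrableOn (fun ω => ‖θ (k + 1) ω - θs‖ ^ p) (stayIn B θ k) P := by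
  obtain ⟨R, hRad⟩ := exists_radius h θs
  refine integrableOn_of_ae_bound (hR.measurableSet_stayIn' h k)
    (((hR.measurable (k + 1)).sub_const θs).norm.pow_const p).aestronglyMeasurable
    (C := (R + |η k| * L) ^ p) ?_
  filter_upwards [hR.ae_norm_batchGrad_le h] with ω hω hA
  rw [norm_pow, norm_norm, hR.step, sub_right_comm]
  have h1 := hω k (hA k le_rfl)
  gcongr
  refine (norm_sub_le _ _).trans (add_le_add (hRad _ (hA k le_rfl)) ?_)
  rw [norm_smul, Real.norm_eq_abs]
  gcongr

theorem integrableOn_pow_mul_inner (hR : SGDRun ℓ q P ℱ η D θ) (h : RegularLoss ℓ q B L K₁ K₂)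
    (θs : Param d) (k p : ℕ) :
    IntegrableOn (fun ω => ‖θ k ω - θs‖ ^ p * ⟪θ k ω - θs, batchGrad ℓ (D k ω) (θ k ω)⟫)
      (stayIn B θ k) P := by
  obtain ⟨R, hRad⟩ := exists_radius h θs
  have hΔ : Measurable fun ω => θ k ω - θs := (hR.measurable k).sub_const θs
  refine integrableOn_of_ae_bound (hR.measurableSet_stayIn' h k)
    ((hΔ.norm.pow_const p).mul
      (hΔ.inner (𝕜 := ℝ) (hR.measurable_batchGrad' h k))).aestronglyMeasurable
    (C := R ^ p * (R * L)) ?_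
  filter_upwards [hR.ae_norm_batchGrad_le h] with ω hω hA
  have h1 := hω k (hA k le_rfl)
  have h2 := hRad _ (hA k le_rfl)
  have h3 : 0 ≤ R := (norm_nonneg _).trans h2
  rw [norm_mul, norm_pow, norm_norm]
  gcongr
  exact (norm_inner_le_norm _ _).trans (by gcongr)

variable [IsProbabilityMeasure q]

/-- The expected SGD drift pulls the iterate towards the minimum. -/
theorem le_setIntegral_pow_mul_inner (hR : SGDRun ℓ q P ℱ η D θ) (h : RegularLoss ℓ q B L K₁ K₂)
    (hθs : θs ∈ interior B) (hmin : IsLocalMin (expectedLoss ℓ q) θs) {μ : ℝ} (hμ : 0 < μ)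
    (hsc : StrongConvexOn B μ (expectedLoss ℓ q)) (k p : ℕ) :
    μ / 2 * ∫ ω in stayIn B θ k, ‖θ k ω - θs‖ ^ (p + 2) ∂P ≤
      ∫ ω in stayIn B θ k,
        ‖θ k ω - θs‖ ^ p * ⟪θ k ω - θs, batchGrad ℓ (D k ω) (θ k ω)⟫ ∂P := by
  obtain ⟨R, hRad⟩ := exists_radius h θs
  have hA := hR.measurableSet_stayIn h k
  have hA' := hR.measurableSet_stayIn' h k
  have hΔ : Measurable[ℱ k] fun ω => θ k ω - θs := (hR.meas k).sub_const θs
  -- Freezing is applied to the vector ‖Δ‖^p Δ; p = 0 serves the second moment and p = 2 the fourth.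
  have hV : Measurable[ℱ k] fun ω => ‖θ k ω - θs‖ ^ p • (θ k ω - θs) :=
    ((measurable_norm.pow_const p).smul measurable_id :
      Measurable fun x : Param d => ‖x‖ ^ p • x).comp hΔ
  have key := (hR.fresh k).setIntegral_inner_batchGrad h (ℱ.le k) hA (hR.meas k) hV
    (fun ω hω => hω k le_rfl) (M := R ^ p * R) (Eventually.of_forall fun ω hω => by
      have h2 := hRad _ (hω k le_rfl)
      have h3 : 0 ≤ R := (norm_nonneg _).trans h2
      rw [norm_smul, norm_pow, norm_norm]
      gcongr)
  simp only [real_inner_smul_left] at key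
  rw [key, ← integral_const_mul]
  refine setIntegral_mono_on ((hR.integrableOn_norm_pow h θs le_rfl _).const_mul _) ?_ hA'
    fun ω hω => ?_
  · refine integrableOn_of_ae_bound hA' (C := R ^ p * (R * L)) ?_
      (Eventually.of_forall fun ω hω => ?_)
    · have hΔ' : Measurable fun ω => θ k ω - θs := (hR.measurable k).sub_const θs
      exact ((hΔ'.norm.pow_const p).mul (hΔ'.inner (𝕜 := ℝ)
        (h.measurable_meanGrad.comp (hR.measurable k)))).aestronglyMeasurable
    · have h1 := h.norm_meanGrad_le (hω k le_rfl)
      have h2 := hRad _ (hω k le_rfl)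
      have h3 : 0 ≤ R := (norm_nonneg _).trans h2
      rw [norm_mul, norm_pow, norm_norm]
      gcongr
      exact (norm_inner_le_norm _ _).trans (by gcongr)
  · have h1 := h.le_inner_meanGrad hθs hmin hμ hsc (hω k le_rfl)
    have h2 : 0 ≤ ‖θ k ω - θs‖ ^ p := by positivity
    calc μ / 2 * ‖θ k ω - θs‖ ^ (p + 2) = ‖θ k ω - θs‖ ^ p * (μ / 2 * ‖θ k ω - θs‖ ^ 2) := by ring
      _ ≤ _ := by gcongr

/-- Enlarging A_{k+1} to A_k leaves an event known before batch k. There the cross term of the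
expanded square contributes the contraction 2η_k · μ/2, and the squared gradient is at most L². -/
theorem second_moment_step (hR : SGDRun ℓ q P ℱ η D θ) (h : RegularLoss ℓ q B L K₁ K₂)
    (hθs : θs ∈ interior B) (hmin : IsLocalMin (expectedLoss ℓ q) θs) {μ : ℝ} (hμ : 0 < μ)
    (hsc : StrongConvexOn B μ (expectedLoss ℓ q)) {k : ℕ} (hη : 0 < η k) :
    ∫ ω in stayIn B θ (k + 1), ‖θ (k + 1) ω - θs‖ ^ 2 ∂P ≤
      (1 - μ * η k) * ∫ ω in stayIn B θ k, ‖θ k ω - θs‖ ^ 2 ∂P + L ^ 2 * η k ^ 2 := by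
  have hA' := hR.measurableSet_stayIn' h k
  have hdrift := hR.le_setIntegral_pow_mul_inner h hθs hmin hμ hsc k 0
  have hi1 := hR.integrableOn_norm_pow h θs (le_refl k) 2
  have hi2 := hR.integrableOn_pow_mul_inner h θs k 0
  simp only [pow_zero, one_mul, zero_add] at hdrift hi2
  have hi3 := hi2.const_mul (2 * η k)
  have hi4 : IntegrableOn (fun ω => ‖θ k ω - θs‖ ^ 2 -
      2 * η k * ⟪θ k ω - θs, batchGrad ℓ (D k ω) (θ k ω)⟫) (stayIn B θ k) P := hi1.sub hi3
  have hc : IntegrableOn (fun _ : Ω => η k ^ 2 * L ^ 2) (stayIn B θ k) P := integrable_const _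
  have hmass : P.real (stayIn B θ k) ≤ 1 := measureReal_le_one
  calc _ ≤ ∫ ω in stayIn B θ k, ‖θ (k + 1) ω - θs‖ ^ 2 ∂P :=
        setIntegral_le_setIntegral_of_subset (stayIn_anti k.le_succ) (fun ω => by positivity)
          (hR.integrableOn_norm_next_pow h θs k 2)
    _ ≤ ∫ ω in stayIn B θ k, (‖θ k ω - θs‖ ^ 2 -
          2 * η k * ⟪θ k ω - θs, batchGrad ℓ (D k ω) (θ k ω)⟫ + η k ^ 2 * L ^ 2) ∂P := by
        refine setIntegral_mono_on_ae (hR.integrableOn_norm_next_pow h θs k 2) (hi4.add hc) hA' ?_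
        filter_upwards [hR.ae_norm_batchGrad_le h] with ω hω hA
        rw [hR.norm_next_sq]
        have := hω k (hA k le_rfl)
        gcongr
    _ = ∫ ω in stayIn B θ k, ‖θ k ω - θs‖ ^ 2 ∂P - 2 * η k *
          ∫ ω in stayIn B θ k, ⟪θ k ω - θs, batchGrad ℓ (D k ω) (θ k ω)⟫ ∂P +
            P.real (stayIn B θ k) * (η k ^ 2 * L ^ 2) := by
        rw [integral_add hi4 hc, integral_sub hi1 hi3, integral_const_mul, setIntegral_const,
          smul_eq_mul]
    _ ≤ ∫ ω in stayIn B θ k, ‖θ k ω - θs‖ ^ 2 ∂P - 2 * η k *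
          (μ / 2 * ∫ ω in stayIn B θ k, ‖θ k ω - θs‖ ^ 2 ∂P) + 1 * (η k ^ 2 * L ^ 2) := by
        gcongr
    _ = _ := by ring

/-- The second moment on the right is already O(η_k), so the forcing is O(η_k³), as a fourth moment
of order η_k² requires. -/
theorem fourth_moment_step (hR : SGDRun ℓ q P ℱ η D θ) (h : RegularLoss ℓ q B L K₁ K₂)
    (hθs : θs ∈ interior B) (hmin : IsLocalMin (expectedLoss ℓ q) θs) {μ : ℝ} (hμ : 0 < μ)
    (hsc : StrongConvexOn B μ (expectedLoss ℓ q)) {k : ℕ} (hη : 0 < η k) :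
    ∫ ω in stayIn B θ (k + 1), ‖θ (k + 1) ω - θs‖ ^ 4 ∂P ≤
      (1 - 2 * μ * η k) * ∫ ω in stayIn B θ k, ‖θ k ω - θs‖ ^ 4 ∂P +
        10 * L ^ 2 * η k ^ 2 * ∫ ω in stayIn B θ k, ‖θ k ω - θs‖ ^ 2 ∂P +
          2 * L ^ 4 * η k ^ 4 := by
  have hA' := hR.measurableSet_stayIn' h k
  have hdrift := hR.le_setIntegral_pow_mul_inner h hθs hmin hμ hsc k 2
  norm_num only at hdrift
  have hi1 := hR.integrableOn_norm_pow h θs (le_refl k) 4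
  have hi3 := (hR.integrableOn_pow_mul_inner h θs k 2).const_mul (4 * η k)
  have hi4 : IntegrableOn (fun ω => ‖θ k ω - θs‖ ^ 4 - 4 * η k * (‖θ k ω - θs‖ ^ 2 *
      ⟪θ k ω - θs, batchGrad ℓ (D k ω) (θ k ω)⟫)) (stayIn B θ k) P := hi1.sub hi3
  have hi5 : IntegrableOn (fun ω => 10 * L ^ 2 * η k ^ 2 * ‖θ k ω - θs‖ ^ 2) (stayIn B θ k) P :=
    (hR.integrableOn_norm_pow h θs (le_refl k) 2).const_mul _
  have hi6 : IntegrableOn (fun ω => ‖θ k ω - θs‖ ^ 4 - 4 * η k * (‖θ k ω - θs‖ ^ 2 *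
      ⟪θ k ω - θs, batchGrad ℓ (D k ω) (θ k ω)⟫) + 10 * L ^ 2 * η k ^ 2 * ‖θ k ω - θs‖ ^ 2)
      (stayIn B θ k) P := hi4.add hi5
  have hc : IntegrableOn (fun _ : Ω => 2 * L ^ 4 * η k ^ 4) (stayIn B θ k) P := integrable_const _
  have hmass : P.real (stayIn B θ k) ≤ 1 := measureReal_le_one
  calc _ ≤ ∫ ω in stayIn B θ k, ‖θ (k + 1) ω - θs‖ ^ 4 ∂P :=
        setIntegral_le_setIntegral_of_subset (stayIn_anti k.le_succ) (fun ω => by positivity)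
          (hR.integrableOn_norm_next_pow h θs k 4)
    _ ≤ ∫ ω in stayIn B θ k, (‖θ k ω - θs‖ ^ 4 - 4 * η k * (‖θ k ω - θs‖ ^ 2 *
          ⟪θ k ω - θs, batchGrad ℓ (D k ω) (θ k ω)⟫) + 10 * L ^ 2 * η k ^ 2 * ‖θ k ω - θs‖ ^ 2 +
            2 * L ^ 4 * η k ^ 4) ∂P := by
        refine setIntegral_mono_on_ae (hR.integrableOn_norm_next_pow h θs k 4) (hi6.add hc) hA' ?_
        filter_upwards [hR.ae_norm_batchGrad_le h] with ω hω hA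
        have hw := hω k (hA k le_rfl)
        have e : ‖θ (k + 1) ω - θs‖ ^ 4 = (‖θ (k + 1) ω - θs‖ ^ 2) ^ 2 := by ring
        rw [e, hR.norm_next_sq]
        have hs := abs_real_inner_le_norm (θ k ω - θs) (batchGrad ℓ (D k ω) (θ k ω))
        set x := ‖θ k ω - θs‖ with hx
        set s := ⟪θ k ω - θs, batchGrad ℓ (D k ω) (θ k ω)⟫ with hsdef
        set w := ‖batchGrad ℓ (D k ω) (θ k ω)‖ with hwdef
        have hw0 : 0 ≤ w := norm_nonneg _
        have hw2 : w ^ 2 ≤ L ^ 2 := by gcongr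
        have hw4 : (w ^ 2) ^ 2 ≤ (L ^ 2) ^ 2 := by gcongr
        have hs2 : s ^ 2 ≤ x ^ 2 * L ^ 2 := by
          calc s ^ 2 = |s| ^ 2 := (sq_abs s).symm
            _ ≤ (x * w) ^ 2 := by gcongr
            _ = x ^ 2 * w ^ 2 := by ring
            _ ≤ _ := by gcongr
        have h1 : η k ^ 2 * s ^ 2 ≤ η k ^ 2 * (x ^ 2 * L ^ 2) := by gcongr
        have h2 : η k ^ 4 * (w ^ 2) ^ 2 ≤ η k ^ 4 * (L ^ 2) ^ 2 := by gcongr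
        have h3 : x ^ 2 * η k ^ 2 * w ^ 2 ≤ x ^ 2 * η k ^ 2 * L ^ 2 := by gcongr
        -- Expand (x² + (η²w² - 2ηs))². The hint gives (2ηs - η²w²)² ≤ 8η²s² + 2η⁴w⁴; together with
        -- 2x²η²w² this yields the constants 10 = 2 + 8 and 2.
        nlinarith [sq_nonneg (2 * η k * s + η k ^ 2 * w ^ 2)]
    _ = ∫ ω in stayIn B θ k, ‖θ k ω - θs‖ ^ 4 ∂P - 4 * η k *
          ∫ ω in stayIn B θ k, ‖θ k ω - θs‖ ^ 2 *
            ⟪θ k ω - θs, batchGrad ℓ (D k ω) (θ k ω)⟫ ∂P +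
              10 * L ^ 2 * η k ^ 2 * ∫ ω in stayIn B θ k, ‖θ k ω - θs‖ ^ 2 ∂P +
            P.real (stayIn B θ k) * (2 * L ^ 4 * η k ^ 4) := by
        rw [integral_add hi6 hc, integral_add hi4 hi5, integral_sub hi1 hi3, integral_const_mul,
          integral_const_mul, setIntegral_const, smul_eq_mul]
    _ ≤ ∫ ω in stayIn B θ k, ‖θ k ω - θs‖ ^ 4 ∂P - 4 * η k *
          (μ / 2 * ∫ ω in stayIn B θ k, ‖θ k ω - θs‖ ^ 4 ∂P) +
              10 * L ^ 2 * η k ^ 2 * ∫ ω in stayIn B θ k, ‖θ k ω - θs‖ ^ 2 ∂P +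
            1 * (2 * L ^ 4 * η k ^ 4) := by
        gcongr
    _ = _ := by ring

/-- The second and fourth moments of the distance to the minimum are `O(η)` and `O(η²)`. -/
theorem exists_moment_bounds (hR : SGDRun ℓ q P ℱ η D θ) (h : RegularLoss ℓ q B L K₁ K₂)
    (hθs : θs ∈ interior B) (hmin : IsLocalMin (expectedLoss ℓ q) θs) {μ : ℝ} (hμ : 0 < μ)
    (hsc : StrongConvexOn B μ (expectedLoss ℓ q)) (hη : ∀ k, 0 < η k)
    (hη0 : Tendsto η atTop (𝓝 0))
    (hslow : ∀ ε > 0, ∀ᶠ k in atTop, η k * (1 - ε * η k) ≤ η (k + 1)) :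
    ∃ C, 0 ≤ C ∧ (∀ k, ∫ ω in stayIn B θ k, ‖θ k ω - θs‖ ^ 2 ∂P ≤ C * η k) ∧
      ∀ k, ∫ ω in stayIn B θ k, ‖θ k ω - θs‖ ^ 4 ∂P ≤ C * η k ^ 2 := by
  obtain ⟨C, hC0, hC⟩ := exists_le_mul_pow_of_recursion
    (u := fun k => ∫ ω in stayIn B θ k, ‖θ k ω - θs‖ ^ 2 ∂P) 1 hμ (sq_nonneg L) hη hη0 hslow
    fun k => hR.second_moment_step h hθs hmin hμ hsc (hη k)
  -- A bound `s` on the steps turns the η⁴ term into an η³ term, the form needed for p = 2.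
  obtain ⟨s, hs⟩ := hη0.bddAbove_range
  have hs' : ∀ k, η k ≤ s := fun k => hs ⟨k, rfl⟩
  have hs0 : 0 ≤ s := (hη 0).le.trans (hs' 0)
  obtain ⟨C', hC0', hC'⟩ := exists_le_mul_pow_of_recursion
    (u := fun k => ∫ ω in stayIn B θ k, ‖θ k ω - θs‖ ^ 4 ∂P) (M := 10 * L ^ 2 * C + 2 * L ^ 4 * s) 2
    (show 0 < 2 * μ by positivity) (by positivity) hη hη0 hslow fun k => by
      refine (hR.fourth_moment_step h hθs hmin hμ hsc (hη k)).trans ?_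
      have h0 := (hη k).le
      have h1 := hC k
      have h2 := hs' k
      rw [pow_one] at h1
      have h3 : 10 * L ^ 2 * η k ^ 2 * ∫ ω in stayIn B θ k, ‖θ k ω - θs‖ ^ 2 ∂P ≤
          10 * L ^ 2 * η k ^ 2 * (C * η k) := by gcongr
      have h4 : 2 * L ^ 4 * η k ^ 3 * η k ≤ 2 * L ^ 4 * η k ^ 3 * s := by gcongr
      rw [show 2 * L ^ 4 * η k ^ 4 = 2 * L ^ 4 * η k ^ 3 * η k by ring]
      exact (add_le_add (add_le_add le_rfl h3) h4).trans_eq (by ring)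
  refine ⟨max C C', le_max_of_le_left hC0, fun k => ?_, fun k => ?_⟩
  · refine (hC k).trans ?_
    rw [pow_one]
    exact mul_le_mul_of_nonneg_right (le_max_left _ _) (hη k).le
  · exact (hC' k).trans (mul_le_mul_of_nonneg_right (le_max_right _ _) (sq_nonneg _))

end Moments

end SGDRun

/-! ### The accumulated noise as a martingale. -/

/-- The accumulated gradient noise of the first `n` steps. -/
noncomputable def accumulatedNoise {d : ℕ} {Ω Z : Type*} [MeasurableSpace Z]
    (ℓ : Param d → Z → ℝ) (q : Measure Z) {b : ℕ → ℕ} (D : (k : ℕ) → Ω → Fin (b k) → Z)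
    (θ : ℕ → Ω → Param d) (n : ℕ) (ω : Ω) : Param d :=
  ∑ i ∈ Finset.range n, (batchGrad ℓ (D i ω) (θ i ω) - meanGrad ℓ q (θ i ω))

namespace SGDRun

variable {d : ℕ} {Ω Z : Type*} [mΩ : MeasurableSpace Ω] [MeasurableSpace Z]
  {ℓ : Param d → Z → ℝ} {q : Measure Z} {P : Measure Ω} {ℱ : Filtration ℕ mΩ} {η : ℕ → ℝ}
  {b : ℕ → ℕ} {D : (k : ℕ) → Ω → Fin (b k) → Z} {θ : ℕ → Ω → Param d}
  {B : Set (Param d)} {L : ℝ} {K₁ K₂ : ℝ≥0} {θs : Param d} [IsProbabilityMeasure q]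

theorem measurable_accumulatedNoise (hR : SGDRun ℓ q P ℱ η D θ) (h : RegularLoss ℓ q B L K₁ K₂)
    (n : ℕ) : Measurable[ℱ n] (accumulatedNoise ℓ q D θ n) := by
  refine Finset.measurable_fun_sum _ fun i hi => ?_
  have hin : i + 1 ≤ n := Finset.mem_range.1 hi
  exact ((hR.measurable_batchGrad h i).mono (ℱ.mono hin) le_rfl).sub
    (h.measurable_meanGrad.comp ((hR.meas i).mono (ℱ.mono (i.le_succ.trans hin)) le_rfl))

theorem measurable_accumulatedNoise' (hR : SGDRun ℓ q P ℱ η D θ)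
    (h : RegularLoss ℓ q B L K₁ K₂) (n : ℕ) : Measurable (accumulatedNoise ℓ q D θ n) :=
  (hR.measurable_accumulatedNoise h n).mono (ℱ.le n) le_rfl

theorem ae_norm_noise_le (hR : SGDRun ℓ q P ℱ η D θ) (h : RegularLoss ℓ q B L K₁ K₂) :
    ∀ᵐ ω ∂P, ∀ k, θ k ω ∈ B →
      ‖batchGrad ℓ (D k ω) (θ k ω) - meanGrad ℓ q (θ k ω)‖ ≤ 2 * L := by
  filter_upwards [hR.ae_norm_batchGrad_le h] with ω hω k hk
  linarith [norm_sub_le (batchGrad ℓ (D k ω) (θ k ω)) (meanGrad ℓ q (θ k ω)), hω k hk,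
    h.norm_meanGrad_le hk]

theorem ae_norm_accumulatedNoise_le (hR : SGDRun ℓ q P ℱ η D θ)
    (h : RegularLoss ℓ q B L K₁ K₂) :
    ∀ᵐ ω ∂P, ∀ n, (∀ i < n, θ i ω ∈ B) → ‖accumulatedNoise ℓ q D θ n ω‖ ≤ n * (2 * L) := by
  filter_upwards [hR.ae_norm_noise_le h] with ω hω n hn
  refine (norm_sum_le _ _).trans ((Finset.sum_le_sum fun i hi =>
    hω i (hn i (Finset.mem_range.1 hi))).trans_eq ?_)
  simp

variable [IsProbabilityMeasure P]

theorem memLp_accumulatedNoise (hR : SGDRun ℓ q P ℱ η D θ) (h : RegularLoss ℓ q B L K₁ K₂)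
    {n k : ℕ} (hn : n ≤ k + 1) :
    MemLp (accumulatedNoise ℓ q D θ n) 2 (P.restrict (stayIn B θ k)) := by
  refine MemLp.of_bound (hR.measurable_accumulatedNoise' h n).aestronglyMeasurable
    (n * (2 * L)) ((ae_restrict_iff' (hR.measurableSet_stayIn' h k)).2 ?_)
  filter_upwards [hR.ae_norm_accumulatedNoise_le h] with ω hω hA
  exact hω n fun i hi => hA i (by omega)

theorem memLp_noise (hR : SGDRun ℓ q P ℱ η D θ) (h : RegularLoss ℓ q B L K₁ K₂) (k : ℕ) :
    MemLp (fun ω => batchGrad ℓ (D k ω) (θ k ω) - meanGrad ℓ q (θ k ω)) 2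
      (P.restrict (stayIn B θ k)) := by
  have hm : Measurable fun ω => batchGrad ℓ (D k ω) (θ k ω) - meanGrad ℓ q (θ k ω) :=
    (hR.measurable_batchGrad' h k).sub (h.measurable_meanGrad.comp (hR.measurable k))
  refine MemLp.of_bound hm.aestronglyMeasurable
    (2 * L) ((ae_restrict_iff' (hR.measurableSet_stayIn' h k)).2 ?_)
  filter_upwards [hR.ae_norm_noise_le h] with ω hω hA
  exact hω k (hA k le_rfl)

/-- The noise of step `k` is orthogonal to the noise accumulated before. -/
theorem setIntegral_inner_noise_eq_zero (hR : SGDRun ℓ q P ℱ η D θ)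
    (h : RegularLoss ℓ q B L K₁ K₂) (k : ℕ) :
    ∫ ω in stayIn B θ k, ⟪accumulatedNoise ℓ q D θ k ω,
      batchGrad ℓ (D k ω) (θ k ω) - meanGrad ℓ q (θ k ω)⟫ ∂P = 0 := by
  have hA := hR.measurableSet_stayIn h k
  have hA' := hR.measurableSet_stayIn' h k
  have hbound : ∀ᵐ ω ∂P, ω ∈ stayIn B θ k → ‖accumulatedNoise ℓ q D θ k ω‖ ≤ k * (2 * L) := by
    filter_upwards [hR.ae_norm_accumulatedNoise_le h] with ω hω hA
    exact hω k fun i hi => hA i hi.le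
  have key := (hR.fresh k).setIntegral_inner_batchGrad h (ℱ.le k) hA (hR.meas k)
    (hR.measurable_accumulatedNoise h k) (fun ω hω => hω k le_rfl) hbound
  have hi1 : IntegrableOn (fun ω => ⟪accumulatedNoise ℓ q D θ k ω,
      batchGrad ℓ (D k ω) (θ k ω)⟫) (stayIn B θ k) P := by
    refine integrableOn_of_ae_bound hA' ((hR.measurable_accumulatedNoise' h k).inner (𝕜 := ℝ)
      (hR.measurable_batchGrad' h k)).aestronglyMeasurable (C := k * (2 * L) * L) ?_
    filter_upwards [hbound, hR.ae_norm_batchGrad_le h] with ω h1 h2 hω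
    have h3 := h1 hω
    have h5 := h2 k (hω k le_rfl)
    have h4 := (norm_nonneg _).trans h3
    exact (norm_inner_le_norm _ _).trans (by gcongr)
  have hi2 : IntegrableOn (fun ω => ⟪accumulatedNoise ℓ q D θ k ω,
      meanGrad ℓ q (θ k ω)⟫) (stayIn B θ k) P := by
    refine integrableOn_of_ae_bound hA' ((hR.measurable_accumulatedNoise' h k).inner (𝕜 := ℝ)
      (h.measurable_meanGrad.comp (hR.measurable k))).aestronglyMeasurable
      (C := k * (2 * L) * L) ?_
    filter_upwards [hbound] with ω h1 hω
    have h3 := h1 hω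
    have h5 := h.norm_meanGrad_le (hω k le_rfl)
    have h4 := (norm_nonneg _).trans h3
    exact (norm_inner_le_norm _ _).trans (by gcongr)
  simp only [inner_sub_right]
  rw [integral_sub hi1 hi2, key, sub_self]

theorem integrableOn_gradVariance (hR : SGDRun ℓ q P ℱ η D θ) (h : RegularLoss ℓ q B L K₁ K₂)
    (k : ℕ) : IntegrableOn (fun ω => gradVariance ℓ q (θ k ω)) (stayIn B θ k) P := by
  refine integrableOn_of_ae_bound (hR.measurableSet_stayIn' h k)
    (h.measurable_gradVariance.comp (hR.measurable k)).aestronglyMeasurable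
    (C := (2 * L) ^ 2) (Eventually.of_forall fun ω hω => ?_)
  refine (norm_integral_le_of_norm_le_const (C := (2 * L) ^ 2) ?_).trans_eq (by simp)
  filter_upwards [h.bound] with z hz
  have hB := hω k le_rfl
  rw [norm_pow, norm_norm]
  gcongr
  linarith [norm_sub_le (sampleGrad ℓ z (θ k ω)) (meanGrad ℓ q (θ k ω)), hz _ hB,
    h.norm_meanGrad_le hB]

/-- The noise terms of different steps are orthogonal, so their variances add up. -/
theorem setIntegral_norm_accumulatedNoise_sq_le (hR : SGDRun ℓ q P ℱ η D θ)
    (h : RegularLoss ℓ q B L K₁ K₂) (k : ℕ) :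
    ∫ ω in stayIn B θ k, ‖accumulatedNoise ℓ q D θ (k + 1) ω‖ ^ 2 ∂P ≤
      ∑ i ∈ Finset.range (k + 1), ∫ ω in stayIn B θ i, gradVariance ℓ q (θ i ω) ∂P := by
  -- Both integrals are over A_k, which is known before batch k; there the cross term vanishes.
  -- Passing from A_{k+1} to the larger A_k is left to the induction.
  have hstep : ∀ k, ∫ ω in stayIn B θ k, ‖accumulatedNoise ℓ q D θ (k + 1) ω‖ ^ 2 ∂P ≤
      ∫ ω in stayIn B θ k, ‖accumulatedNoise ℓ q D θ k ω‖ ^ 2 ∂P +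
        ∫ ω in stayIn B θ k, gradVariance ℓ q (θ k ω) ∂P := by
    intro k
    have hS := hR.memLp_accumulatedNoise h (show k ≤ k + 1 by omega)
    have hN := hR.memLp_noise h k
    have hS2 := (memLp_two_iff_integrable_sq_norm hS.1).1 hS
    have hN2 := (memLp_two_iff_integrable_sq_norm hN.1).1 hN
    have hin : Integrable (fun ω => 2 * ⟪accumulatedNoise ℓ q D θ k ω,
        batchGrad ℓ (D k ω) (θ k ω) - meanGrad ℓ q (θ k ω)⟫) (P.restrict (stayIn B θ k)) :=
      ((hS.norm.integrable_mul hN.norm).mono' (hS.1.inner (𝕜 := ℝ) hN.1)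
        (Eventually.of_forall fun ω => norm_inner_le_norm _ _)).const_mul 2
    have hin2 : Integrable (fun ω => ‖accumulatedNoise ℓ q D θ k ω‖ ^ 2 +
        2 * ⟪accumulatedNoise ℓ q D θ k ω, batchGrad ℓ (D k ω) (θ k ω) - meanGrad ℓ q (θ k ω)⟫)
        (P.restrict (stayIn B θ k)) := hS2.add hin
    have e : ∀ ω, ‖accumulatedNoise ℓ q D θ (k + 1) ω‖ ^ 2 = ‖accumulatedNoise ℓ q D θ k ω‖ ^ 2 +
        2 * ⟪accumulatedNoise ℓ q D θ k ω, batchGrad ℓ (D k ω) (θ k ω) - meanGrad ℓ q (θ k ω)⟫ +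
        ‖batchGrad ℓ (D k ω) (θ k ω) - meanGrad ℓ q (θ k ω)‖ ^ 2 := fun ω => by
      rw [accumulatedNoise, Finset.sum_range_succ, ← accumulatedNoise, norm_add_sq_real]
    simp_rw [e]
    rw [integral_add hin2 hN2, integral_add hS2 hin, integral_const_mul,
      hR.setIntegral_inner_noise_eq_zero h k, mul_zero, add_zero]
    refine add_le_add le_rfl ?_
    exact (hR.fresh k).setIntegral_norm_batchGrad_sub_sq_le h (ℱ.le k) (hR.measurableSet_stayIn h k)
      (hR.meas k) (fun ω hω => hω k le_rfl) (hR.integrableOn_gradVariance h k)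
  induction k with
  | zero => simpa [accumulatedNoise] using hstep 0
  | succ k ih =>
    rw [Finset.sum_range_succ]
    refine (hstep (k + 1)).trans (add_le_add_left (le_trans ?_ ih) _)
    have hS := hR.memLp_accumulatedNoise h (le_refl (k + 1))
    exact setIntegral_le_setIntegral_of_subset (stayIn_anti k.le_succ) (fun ω => by positivity)
      ((memLp_two_iff_integrable_sq_norm hS.1).1 hS)

/-- Replaces the variance at the iterate by Tr C at the minimum, with a Lipschitz error that tends
to 0 with the second moment. -/
theorem setIntegral_gradVariance_le (hR : SGDRun ℓ q P ℱ η D θ) (h : RegularLoss ℓ q B L K₁ K₂)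
    (hθs : θs ∈ B) (k : ℕ) :
    ∫ ω in stayIn B θ k, gradVariance ℓ q (θ k ω) ∂P ≤ (gradCovariance ℓ q θs).trace +
      8 * L * K₁ * √(∫ ω in stayIn B θ k, ‖θ k ω - θs‖ ^ 2 ∂P) := by
  have hL := h.bound_nonneg ⟨θs, hθs⟩
  have hi := hR.integrableOn_norm_pow h θs (le_refl k) 1
  simp only [pow_one] at hi
  have hc : IntegrableOn (fun _ : Ω => gradVariance ℓ q θs) (stayIn B θ k) P := integrable_const _
  have hmass : P.real (stayIn B θ k) ≤ 1 := measureReal_le_one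
  have hvar : 0 ≤ gradVariance ℓ q θs := integral_nonneg fun _ => by positivity
  calc _ ≤ ∫ ω in stayIn B θ k, (gradVariance ℓ q θs + 8 * L * K₁ * ‖θ k ω - θs‖) ∂P :=
        setIntegral_mono_on (hR.integrableOn_gradVariance h k) (hc.add (hi.const_mul _))
          (hR.measurableSet_stayIn' h k) fun ω hω => h.gradVariance_le_add hθs (hω k le_rfl)
    _ = P.real (stayIn B θ k) * gradVariance ℓ q θs +
          8 * L * K₁ * ∫ ω in stayIn B θ k, ‖θ k ω - θs‖ ∂P := by
        rw [integral_add hc (hi.const_mul _), setIntegral_const, integral_const_mul, smul_eq_mul]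
    _ ≤ 1 * gradVariance ℓ q θs +
          8 * L * K₁ * √(∫ ω in stayIn B θ k, ‖θ k ω - θs‖ ^ 2 ∂P) := by
        gcongr
        exact integral_le_sqrt_integral_sq (by simp) hi
          (hR.integrableOn_norm_pow h θs (le_refl k) 2)
    _ = _ := by rw [one_mul, h.gradVariance_eq_trace hθs]

end SGDRun

/-! ### L² norms, summation by parts and linearisation. -/

section LpNorm

variable {Ω E : Type*} [MeasurableSpace Ω] [NormedAddCommGroup E] {ν : Measure Ω}

theorem lpNorm_two_eq_sqrt {f : Ω → E} (hf : AEStronglyMeasurable f ν) :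
    lpNorm f 2 ν = √(∫ ω, ‖f ω‖ ^ 2 ∂ν) := by
  rw [lpNorm_eq_integral_norm_rpow_toReal two_ne_zero ENNReal.ofNat_ne_top hf, Real.sqrt_eq_rpow]
  simp

theorem lpNorm_two_mono_ae {f : Ω → E} {g : Ω → ℝ} (hf : AEStronglyMeasurable f ν)
    (hg : MemLp g 2 ν) (h : ∀ᵐ ω ∂ν, ‖f ω‖ ≤ g ω) : lpNorm f 2 ν ≤ lpNorm g 2 ν := by
  rw [lpNorm_two_eq_sqrt hf, lpNorm_two_eq_sqrt hg.1]
  refine Real.sqrt_le_sqrt (integral_mono_of_nonneg (Eventually.of_forall fun ω => by positivity)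
    ((memLp_two_iff_integrable_sq_norm hg.1).1 hg) ?_)
  filter_upwards [h] with ω hω
  have : ‖f ω‖ ≤ ‖g ω‖ := hω.trans (le_abs_self _)
  gcongr

theorem memLp_and_lpNorm_sum_mul_le {ι : Type*} (s : Finset ι) {c β : ι → ℝ} {f : ι → Ω → ℝ}
    (hc : ∀ i ∈ s, 0 ≤ c i) (hf : ∀ i ∈ s, MemLp (f i) 2 ν)
    (hβ : ∀ i ∈ s, lpNorm (f i) 2 ν ≤ β i) :
    MemLp (fun ω => ∑ i ∈ s, c i * f i ω) 2 ν ∧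
      lpNorm (fun ω => ∑ i ∈ s, c i * f i ω) 2 ν ≤ ∑ i ∈ s, c i * β i := by
  have hm : ∀ i ∈ s, MemLp (c i • f i) 2 ν := fun i hi => (hf i hi).const_smul (c i)
  have e : (fun ω => ∑ i ∈ s, c i * f i ω) = ∑ i ∈ s, c i • f i := by
    ext ω; simp
  rw [e]
  refine ⟨memLp_finsetSum' s hm, (lpNorm_sum_le hm (by norm_num)).trans
    (Finset.sum_le_sum fun i hi => ?_)⟩
  rw [lpNorm_const_smul, coe_nnnorm, Real.norm_of_nonneg (hc i hi)]
  exact mul_le_mul_of_nonneg_left (hβ i hi) (hc i hi)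

theorem lpNorm_two_const_le [IsFiniteMeasure ν] (hν : ν.real univ ≤ 1) {c : ℝ} (hc : 0 ≤ c) :
    lpNorm (fun _ : Ω => c) 2 ν ≤ c := by
  rw [lpNorm_two_eq_sqrt aestronglyMeasurable_const, integral_const, smul_eq_mul]
  refine Real.sqrt_le_iff.2 ⟨hc, ?_⟩
  rw [Real.norm_of_nonneg hc]
  nlinarith [sq_nonneg c]

end LpNorm

theorem sqrt_add_le_add_sqrt {x y : ℝ} (hx : 0 ≤ x) (hy : 0 ≤ y) : √(x + y) ≤ √x + √y := by
  refine Real.sqrt_le_iff.2 ⟨by positivity, ?_⟩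
  nlinarith [Real.sq_sqrt hx, Real.sq_sqrt hy, mul_nonneg (Real.sqrt_nonneg x) (Real.sqrt_nonneg y)]

/-- Summation by parts. -/
theorem sum_smul_sub_succ {E : Type*} [AddCommGroup E] [Module ℝ E] (s : ℕ → ℝ) (x : ℕ → E)
    (k : ℕ) : ∑ i ∈ Finset.range (k + 1), s i • (x i - x (i + 1)) =
      s 0 • x 0 + ∑ i ∈ Finset.range k, (s (i + 1) - s i) • x (i + 1) - s k • x (k + 1) := by
  induction k with
  | zero => simp [smul_sub]
  | succ k ih =>
    rw [Finset.sum_range_succ, ih, Finset.sum_range_succ (n := k)]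
    module

/-- Weighted increments of `1 / η`, against `√η`, telescope. -/
theorem sum_increment_inv_mul_sqrt_le {η : ℕ → ℝ} (hη : ∀ k, 0 < η k) (hanti : Antitone η)
    (k : ℕ) : ∑ i ∈ Finset.range k, ((η (i + 1))⁻¹ - (η i)⁻¹) * √(η (i + 1)) ≤
      2 * (√(η k))⁻¹ - 2 * (√(η 0))⁻¹ := by
  induction k with
  | zero => simp
  | succ k ih =>
    rw [Finset.sum_range_succ]
    have h1 : 0 < √(η k) := Real.sqrt_pos.2 (hη k)
    have h2 : 0 < √(η (k + 1)) := Real.sqrt_pos.2 (hη _)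
    have h3 : √(η (k + 1)) ≤ √(η k) := Real.sqrt_le_sqrt (hanti k.le_succ)
    have h4 : (√(η k))⁻¹ ≤ (√(η (k + 1)))⁻¹ := inv_anti₀ h2 h3
    -- With x = η_{k+1}^(-1/2) and y = η_k^(-1/2) ≤ x this reads (x² - y²)/x ≤ 2(x - y), which holds
    -- because x + y ≤ 2x.
    have key : ((η (k + 1))⁻¹ - (η k)⁻¹) * √(η (k + 1)) ≤
        2 * ((√(η (k + 1)))⁻¹ - (√(η k))⁻¹) := by
      have e1 : (η (k + 1))⁻¹ = (√(η (k + 1)))⁻¹ ^ 2 := by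
        rw [inv_pow, Real.sq_sqrt (hη _).le]
      have e2 : (η k)⁻¹ = (√(η k))⁻¹ ^ 2 := by rw [inv_pow, Real.sq_sqrt (hη _).le]
      rw [e1, e2]
      set x := (√(η (k + 1)))⁻¹ with hx
      set y := (√(η k))⁻¹ with hy
      have hx0 : 0 < x := inv_pos.2 h2
      have e3 : √(η (k + 1)) = x⁻¹ := by rw [hx, inv_inv]
      rw [e3, ← div_eq_mul_inv, div_le_iff₀ hx0]
      nlinarith
    linarith

/-- The linearisation of the mean gradient expresses the sum of the errors through the accumulated
noise, the sum of the batch gradients and the quadratic remainders. -/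
theorem RegularLoss.norm_meanHessian_sum_le {d : ℕ} {Ω Z : Type*} [MeasurableSpace Z]
    {ℓ : Param d → Z → ℝ} {q : Measure Z} {b : ℕ → ℕ} {D : (k : ℕ) → Ω → Fin (b k) → Z}
    {θ : ℕ → Ω → Param d} {B : Set (Param d)} {L : ℝ} {K₁ K₂ : ℝ≥0} {θs : Param d}
    [IsProbabilityMeasure q] (h : RegularLoss ℓ q B L K₁ K₂) (hθs : θs ∈ interior B)
    (hG : meanGrad ℓ q θs = 0) {k : ℕ} {ω : Ω} (hω : ω ∈ stayIn B θ k) :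
    ‖Matrix.toEuclideanLin (meanHessian ℓ q θs)
        (∑ i ∈ Finset.range (k + 1), (θ i ω - θs))‖ ≤
      ‖accumulatedNoise ℓ q D θ (k + 1) ω‖ +
        ‖∑ i ∈ Finset.range (k + 1), batchGrad ℓ (D i ω) (θ i ω)‖ +
          ∑ i ∈ Finset.range (k + 1), K₂ * ‖θ i ω - θs‖ ^ 2 := by
  have hrem : ‖∑ i ∈ Finset.range (k + 1), (meanGrad ℓ q (θ i ω) -
      Matrix.toEuclideanLin (meanHessian ℓ q θs) (θ i ω - θs))‖ ≤
        ∑ i ∈ Finset.range (k + 1), K₂ * ‖θ i ω - θs‖ ^ 2 := by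
    refine (norm_sum_le _ _).trans (Finset.sum_le_sum fun i hi => ?_)
    have := h.norm_meanGrad_sub_sub_meanHessian_le hθs
      (hω i (Nat.lt_succ_iff.1 (Finset.mem_range.1 hi)))
    rwa [hG, sub_zero] at this
  have e : Matrix.toEuclideanLin (meanHessian ℓ q θs)
        (∑ i ∈ Finset.range (k + 1), (θ i ω - θs)) =
      ∑ i ∈ Finset.range (k + 1), batchGrad ℓ (D i ω) (θ i ω) -
        accumulatedNoise ℓ q D θ (k + 1) ω -
          ∑ i ∈ Finset.range (k + 1), (meanGrad ℓ q (θ i ω) -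
            Matrix.toEuclideanLin (meanHessian ℓ q θs) (θ i ω - θs)) := by
    rw [map_sum, accumulatedNoise, ← Finset.sum_sub_distrib, ← Finset.sum_sub_distrib]
    refine Finset.sum_congr rfl fun i _ => ?_
    abel
  rw [e]
  refine (norm_sub_le _ _).trans (add_le_add ((norm_sub_le _ _).trans ?_) hrem)
  rw [add_comm]

/-! ### The mean square error of the averaged iterate. -/

namespace SGDRun

variable {d : ℕ} {Ω Z : Type*} [mΩ : MeasurableSpace Ω] [MeasurableSpace Z]
  {ℓ : Param d → Z → ℝ} {q : Measure Z} {P : Measure Ω} {ℱ : Filtration ℕ mΩ} {η : ℕ → ℝ}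
  {b : ℕ → ℕ} {D : (k : ℕ) → Ω → Fin (b k) → Z} {θ : ℕ → Ω → Param d}
  {B : Set (Param d)} {L : ℝ} {K₁ K₂ : ℝ≥0} {θs : Param d}

/-- Each batch gradient is an increment of the iterates divided by its step, so Abel summation moves
the differences onto 1/η, which is monotone. -/
theorem norm_sum_batchGrad_le (hR : SGDRun ℓ q P ℱ η D θ) (hη : ∀ k, 0 < η k) (hanti : Antitone η)
    (θs : Param d) (k : ℕ) (ω : Ω) :
    ‖∑ i ∈ Finset.range (k + 1), batchGrad ℓ (D i ω) (θ i ω)‖ ≤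
      (η 0)⁻¹ * ‖θ 0 ω - θs‖ +
        ∑ i ∈ Finset.range k, ((η (i + 1))⁻¹ - (η i)⁻¹) * ‖θ (i + 1) ω - θs‖ +
          (η k)⁻¹ * ‖θ k ω - θs‖ + ‖batchGrad ℓ (D k ω) (θ k ω)‖ := by
  have e : ∀ i, batchGrad ℓ (D i ω) (θ i ω) =
      (η i)⁻¹ • ((θ i ω - θs) - (θ (i + 1) ω - θs)) := fun i => by
    rw [hR.step, sub_sub_sub_cancel_right, sub_sub_cancel, smul_smul,
      inv_mul_cancel₀ (hη i).ne', one_smul]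
  -- A_k says nothing about θ_{k+1}; the boundary term is traded for θ_k and one last batch
  -- gradient, bounded by L.
  have e2 : (η k)⁻¹ • (θ (k + 1) ω - θs) =
      (η k)⁻¹ • (θ k ω - θs) - batchGrad ℓ (D k ω) (θ k ω) := by
    rw [e k]; module
  rw [Finset.sum_congr rfl fun i _ => e i, sum_smul_sub_succ (fun i => (η i)⁻¹)
    (fun i => θ i ω - θs), e2, ← sub_add]
  have h0 : ∀ i, 0 ≤ (η i)⁻¹ := fun i => (inv_pos.2 (hη i)).le
  have h1 : ∀ i, 0 ≤ (η (i + 1))⁻¹ - (η i)⁻¹ := fun i =>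
    sub_nonneg.2 (inv_anti₀ (hη _) (hanti i.le_succ))
  refine (norm_add_le _ _).trans (add_le_add_left ((norm_sub_le _ _).trans (add_le_add
    ((norm_add_le _ _).trans (add_le_add ?_ ((norm_sum_le _ _).trans (Finset.sum_le_sum
      fun i _ => ?_)))) ?_)) _)
  · rw [norm_smul, Real.norm_of_nonneg (h0 0)]
  · rw [norm_smul, Real.norm_of_nonneg (h1 i)]
  · rw [norm_smul, Real.norm_of_nonneg (h0 k)]

theorem memLp_sub [IsProbabilityMeasure P] (hR : SGDRun ℓ q P ℱ η D θ)
    (h : RegularLoss ℓ q B L K₁ K₂) (θs : Param d) {i k : ℕ} (hik : i ≤ k) :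
    MemLp (fun ω => ‖θ i ω - θs‖) 2 (P.restrict (stayIn B θ k)) ∧
      lpNorm (fun ω => ‖θ i ω - θs‖) 2 (P.restrict (stayIn B θ k)) ≤
        √(∫ ω in stayIn B θ i, ‖θ i ω - θs‖ ^ 2 ∂P) := by
  have hm : AEStronglyMeasurable (fun ω => ‖θ i ω - θs‖) (P.restrict (stayIn B θ k)) :=
    ((hR.measurable i).sub_const θs).norm.aestronglyMeasurable
  refine ⟨(memLp_two_iff_integrable_sq hm).2 (hR.integrableOn_norm_pow h θs hik 2), ?_⟩
  rw [lpNorm_two_eq_sqrt hm]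
  simp only [norm_norm]
  exact Real.sqrt_le_sqrt (setIntegral_le_setIntegral_of_subset (stayIn_anti hik)
    (fun ω => by positivity) (hR.integrableOn_norm_pow h θs le_rfl 2))

/-- The L² norm of a squared distance is a fourth moment; this is why the quadratic remainders call
for fourth moments. -/
theorem memLp_sub_sq [IsProbabilityMeasure P] (hR : SGDRun ℓ q P ℱ η D θ)
    (h : RegularLoss ℓ q B L K₁ K₂) (θs : Param d) {i k : ℕ} (hik : i ≤ k) :
    MemLp (fun ω => ‖θ i ω - θs‖ ^ 2) 2 (P.restrict (stayIn B θ k)) ∧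
      lpNorm (fun ω => ‖θ i ω - θs‖ ^ 2) 2 (P.restrict (stayIn B θ k)) ≤
        √(∫ ω in stayIn B θ i, ‖θ i ω - θs‖ ^ 4 ∂P) := by
  have hm : AEStronglyMeasurable (fun ω => ‖θ i ω - θs‖ ^ 2) (P.restrict (stayIn B θ k)) :=
    (((hR.measurable i).sub_const θs).norm.pow_const 2).aestronglyMeasurable
  have e : ∀ ω, (‖θ i ω - θs‖ ^ 2) ^ 2 = ‖θ i ω - θs‖ ^ 4 := fun ω => by ring
  refine ⟨(memLp_two_iff_integrable_sq hm).2 ?_, ?_⟩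
  · simp_rw [e]
    exact hR.integrableOn_norm_pow h θs hik 4
  · rw [lpNorm_two_eq_sqrt hm]
    simp only [norm_pow, norm_norm, e]
    exact Real.sqrt_le_sqrt (setIntegral_le_setIntegral_of_subset (stayIn_anti hik)
      (fun ω => by positivity) (hR.integrableOn_norm_pow h θs le_rfl 4))

variable [IsProbabilityMeasure q]

variable [IsProbabilityMeasure P]

/-- A nonasymptotic bound for the averaged iterate, in terms of the moments of the iterates. -/
theorem lpNorm_sum_sub_le (hR : SGDRun ℓ q P ℱ η D θ) (h : RegularLoss ℓ q B L K₁ K₂)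
    (hθs : θs ∈ interior B) (hG : meanGrad ℓ q θs = 0) (hH : (meanHessian ℓ q θs).PosDef)
    (hη : ∀ k, 0 < η k) (hanti : Antitone η) {C : ℝ} (hC0 : 0 ≤ C)
    (hu : ∀ k, ∫ ω in stayIn B θ k, ‖θ k ω - θs‖ ^ 2 ∂P ≤ C * η k)
    (hv : ∀ k, ∫ ω in stayIn B θ k, ‖θ k ω - θs‖ ^ 4 ∂P ≤ C * η k ^ 2) (k : ℕ) :
    lpNorm (fun ω => ∑ i ∈ Finset.range (k + 1), (θ i ω - θs)) 2 (P.restrict (stayIn B θ k)) ≤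
      (meanHessian ℓ q θs)⁻¹.trace * (√((gradCovariance ℓ q θs).trace) * √((k : ℝ) + 1) +
        (√(∑ i ∈ Finset.range (k + 1), 8 * L * K₁ * √(C * η i)) +
          ∑ i ∈ Finset.range (k + 1), K₂ * (√C * η i) + 3 * √C * (√(η k))⁻¹ + L)) := by
  set ν := P.restrict (stayIn B θ k) with hν
  set τ := (meanHessian ℓ q θs)⁻¹.trace with hτ
  set T := (gradCovariance ℓ q θs).trace with hT
  have hs := interior_subset hθs
  have hL := h.bound_nonneg ⟨θs, hs⟩
  have hτ0 : 0 ≤ τ := hH.inv.posSemidef.trace_nonneg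
  have hT0 : 0 ≤ T := by
    rw [hT, ← h.gradVariance_eq_trace hs]
    exact integral_nonneg fun _ => by positivity
  have hmass : ν.real univ ≤ 1 := by simp [hν]
  have h0 : ∀ i, 0 ≤ (η i)⁻¹ := fun i => (inv_pos.2 (hη i)).le
  have hu' : ∀ i ≤ k, lpNorm (fun ω => ‖θ i ω - θs‖) 2 ν ≤ √C * √(η i) := fun i hi => by
    rw [← Real.sqrt_mul hC0]
    exact (hR.memLp_sub h θs hi).2.trans (Real.sqrt_le_sqrt (hu i))
  have hv' : ∀ i ≤ k, lpNorm (fun ω => ‖θ i ω - θs‖ ^ 2) 2 ν ≤ √C * η i := fun i hi => by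
    refine (hR.memLp_sub_sq h θs hi).2.trans ((Real.sqrt_le_sqrt (hv i)).trans_eq ?_)
    rw [Real.sqrt_mul hC0, Real.sqrt_sq (hη i).le]
  -- Minkowski is applied to six terms: the noise (`g1`), the Abel summation (`g2`, `g3`, `g4`), the
  -- last batch gradient (`g5`) and the quadratic remainders (`g6`).
  set g1 : Ω → ℝ := fun ω => ‖accumulatedNoise ℓ q D θ (k + 1) ω‖ with hg1
  set g2 : Ω → ℝ := (η 0)⁻¹ • fun ω => ‖θ 0 ω - θs‖ with hg2
  set g3 : Ω → ℝ := fun ω => ∑ i ∈ Finset.range k,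
    ((η (i + 1))⁻¹ - (η i)⁻¹) * ‖θ (i + 1) ω - θs‖ with hg3
  set g4 : Ω → ℝ := (η k)⁻¹ • fun ω => ‖θ k ω - θs‖ with hg4
  set g5 : Ω → ℝ := fun _ => L with hg5
  set g6 : Ω → ℝ := fun ω => ∑ i ∈ Finset.range (k + 1), K₂ * ‖θ i ω - θs‖ ^ 2 with hg6
  have m1 : MemLp g1 2 ν := (hR.memLp_accumulatedNoise h le_rfl).norm
  have b1 : lpNorm g1 2 ν ≤
      √T * √((k : ℝ) + 1) + √(∑ i ∈ Finset.range (k + 1), 8 * L * K₁ * √(C * η i)) := by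
    rw [lpNorm_two_eq_sqrt m1.1]
    have hsum : ∫ ω, ‖g1 ω‖ ^ 2 ∂ν ≤
        T * ((k : ℝ) + 1) + ∑ i ∈ Finset.range (k + 1), 8 * L * K₁ * √(C * η i) := by
      simp only [hg1, norm_norm]
      refine (hR.setIntegral_norm_accumulatedNoise_sq_le h k).trans
        ((Finset.sum_le_sum fun i _ => (hR.setIntegral_gradVariance_le h hs i).trans
          (add_le_add le_rfl (mul_le_mul_of_nonneg_left (Real.sqrt_le_sqrt (hu i))
            (by positivity)))).trans_eq ?_)
      rw [Finset.sum_add_distrib, Finset.sum_const, Finset.card_range, nsmul_eq_mul]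
      push_cast
      ring
    refine (Real.sqrt_le_sqrt hsum).trans ?_
    rw [← Real.sqrt_mul hT0]
    exact sqrt_add_le_add_sqrt (by positivity) (by positivity)
  have m2 : MemLp g2 2 ν := (hR.memLp_sub h θs k.zero_le).1.const_smul _
  have b2 : lpNorm g2 2 ν ≤ (η 0)⁻¹ * (√C * √(η 0)) := by
    rw [hg2, lpNorm_const_smul, coe_nnnorm, Real.norm_of_nonneg (h0 0)]
    exact mul_le_mul_of_nonneg_left (hu' 0 k.zero_le) (h0 0)
  obtain ⟨m3, b3⟩ : MemLp g3 2 ν ∧ lpNorm g3 2 ν ≤ ∑ i ∈ Finset.range k,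
      ((η (i + 1))⁻¹ - (η i)⁻¹) * (√C * √(η (i + 1))) :=
    memLp_and_lpNorm_sum_mul_le (f := fun i ω => ‖θ (i + 1) ω - θs‖) _
      (fun i _ => sub_nonneg.2 (inv_anti₀ (hη _) (hanti i.le_succ)))
      (fun i hi => (hR.memLp_sub h θs (Finset.mem_range.1 hi)).1)
      (fun i hi => hu' _ (Finset.mem_range.1 hi))
  have m4 : MemLp g4 2 ν := (hR.memLp_sub h θs le_rfl).1.const_smul _
  have b4 : lpNorm g4 2 ν ≤ (η k)⁻¹ * (√C * √(η k)) := by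
    rw [hg4, lpNorm_const_smul, coe_nnnorm, Real.norm_of_nonneg (h0 k)]
    exact mul_le_mul_of_nonneg_left (hu' k le_rfl) (h0 k)
  have m5 : MemLp g5 2 ν := memLp_const L
  have b5 : lpNorm g5 2 ν ≤ L := lpNorm_two_const_le hmass hL
  obtain ⟨m6, b6⟩ : MemLp g6 2 ν ∧ lpNorm g6 2 ν ≤ ∑ i ∈ Finset.range (k + 1),
      K₂ * (√C * η i) :=
    memLp_and_lpNorm_sum_mul_le (f := fun i ω => ‖θ i ω - θs‖ ^ 2) _
      (fun i _ => K₂.coe_nonneg)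
      (fun i hi => (hR.memLp_sub_sq h θs (Nat.lt_succ_iff.1 (Finset.mem_range.1 hi))).1)
      (fun i hi => hv' _ (Nat.lt_succ_iff.1 (Finset.mem_range.1 hi)))
  have hbound : ∀ᵐ ω ∂ν, ‖∑ i ∈ Finset.range (k + 1), (θ i ω - θs)‖ ≤
      (τ • (g1 + (g2 + (g3 + (g4 + (g5 + g6)))))) ω := by
    rw [hν, ae_restrict_iff' (hR.measurableSet_stayIn' h k)]
    filter_upwards [hR.ae_norm_batchGrad_le h] with ω hω hA
    have a1 := h.norm_meanHessian_sum_le (D := D) hθs hG hA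
    have a2 := hR.norm_sum_batchGrad_le hη hanti θs k ω
    have a3 := hω k (hA k le_rfl)
    refine (norm_le_trace_inv_mul_norm hH _).trans (mul_le_mul_of_nonneg_left ?_ hτ0)
    simp only [hg1, hg2, hg3, hg4, hg5, hg6, Pi.add_apply, Pi.smul_apply, smul_eq_mul]
    linarith
  have hm : Measurable fun ω => ∑ i ∈ Finset.range (k + 1), (θ i ω - θs) :=
    Finset.measurable_fun_sum _ fun i _ => (hR.measurable i).sub_const θs
  have m56 := m5.add m6
  have m46 := m4.add m56
  have m36 := m3.add m46
  have m26 := m2.add m36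
  have hg := lpNorm_two_mono_ae hm.aestronglyMeasurable ((m1.add m26).const_smul τ) hbound
  rw [lpNorm_const_smul, coe_nnnorm, Real.norm_of_nonneg hτ0] at hg
  refine hg.trans (mul_le_mul_of_nonneg_left ?_ hτ0)
  have t1 := lpNorm_add_le (g := g2 + (g3 + (g4 + (g5 + g6)))) m1 one_le_two
  have t2 := lpNorm_add_le (g := g3 + (g4 + (g5 + g6))) m2 one_le_two
  have t3 := lpNorm_add_le (g := g4 + (g5 + g6)) m3 one_le_two
  have t4 := lpNorm_add_le (g := g5 + g6) m4 one_le_two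
  have t5 := lpNorm_add_le (g := g6) m5 one_le_two
  have hinv : ∀ i, (η i)⁻¹ * (√C * √(η i)) = √C * (√(η i))⁻¹ := fun i => by
    have h1 : 0 < √(η i) := Real.sqrt_pos.2 (hη i)
    have h2 : (η i)⁻¹ = (√(η i))⁻¹ ^ 2 := by rw [inv_pow, Real.sq_sqrt (hη i).le]
    rw [h2]
    field_simp
  rw [hinv] at b2 b4
  have htel : ∑ i ∈ Finset.range k, ((η (i + 1))⁻¹ - (η i)⁻¹) * (√C * √(η (i + 1))) ≤
      √C * (2 * (√(η k))⁻¹ - 2 * (√(η 0))⁻¹) := by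
    refine le_trans (le_of_eq ?_) (mul_le_mul_of_nonneg_left
      (sum_increment_inv_mul_sqrt_le hη hanti k) (Real.sqrt_nonneg C))
    rw [Finset.mul_sum]
    exact Finset.sum_congr rfl fun i _ => by ring
  -- The Abel terms add up to √C times η_0^(-1/2) + (2η_k^(-1/2) - 2η_0^(-1/2)) + η_k^(-1/2), at
  -- most 3√C η_k^(-1/2).
  have hpos : 0 ≤ √C * (√(η 0))⁻¹ := by positivity
  linarith

end SGDRun

/-! ### From the averaged iterate to the excess loss. -/

theorem averageIterate_mem {d : ℕ} {Ω : Type*} {B : Set (Param d)} (hB : Convex ℝ B)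
    {θ : ℕ → Ω → Param d} {k : ℕ} {ω : Ω} (hω : ω ∈ stayIn B θ k) :
    averageIterate θ k ω ∈ B := by
  rw [averageIterate, Finset.smul_sum]
  refine hB.sum_mem (fun i _ => by positivity) ?_
    fun i hi => hω i (Nat.lt_succ_iff.1 (Finset.mem_range.1 hi))
  rw [Finset.sum_const, Finset.card_range, nsmul_eq_mul]
  push_cast
  exact mul_inv_cancel₀ (by positivity)

theorem averageIterate_sub {d : ℕ} {Ω : Type*} (θ : ℕ → Ω → Param d) (x : Param d) (k : ℕ)
    (ω : Ω) : averageIterate θ k ω - x =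
      ((k : ℝ) + 1)⁻¹ • ∑ i ∈ Finset.range (k + 1), (θ i ω - x) := by
  have hk : (k : ℝ) + 1 ≠ 0 := by positivity
  rw [averageIterate, Finset.sum_sub_distrib, smul_sub, Finset.sum_const, Finset.card_range,
    ← Nat.cast_smul_eq_nsmul ℝ, smul_smul]
  push_cast
  rw [inv_mul_cancel₀ hk, one_smul]

/-- The excess loss of a random point of `B` is controlled by its mean square distance to the
minimum. -/
theorem RegularLoss.integral_excess_le {d : ℕ} {Ω Z : Type*} [MeasurableSpace Ω]
    [MeasurableSpace Z] {ℓ : Param d → Z → ℝ} {q : Measure Z} [IsProbabilityMeasure q]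
    {B : Set (Param d)} {L : ℝ} {K₁ K₂ : ℝ≥0} (h : RegularLoss ℓ q B L K₁ K₂) {θs : Param d}
    (hθs : θs ∈ B) {ν : Measure Ω} [IsFiniteMeasure ν] (hν : ν.real univ ≤ 1) {x : Ω → Param d}
    (hx : Measurable x) (hxB : ∀ᵐ ω ∂ν, x ω ∈ B) :
    Integrable (fun p : Ω × Z => ℓ (x p.1) p.2 - ℓ θs p.2) (ν.prod q) ∧
      Integrable (fun ω => ‖x ω - θs‖ ^ 2) ν ∧
        ∫ p, (ℓ (x p.1) p.2 - ℓ θs p.2) ∂(ν.prod q) ≤ L * √(∫ ω, ‖x ω - θs‖ ^ 2 ∂ν) := by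
  have hL := h.bound_nonneg ⟨θs, hθs⟩
  obtain ⟨R, hR⟩ := SGDRun.exists_radius h θs
  have hm : Measurable fun ω => ‖x ω - θs‖ := (hx.sub_const θs).norm
  have hi1 : Integrable (fun ω => ‖x ω - θs‖) ν :=
    Integrable.of_bound hm.aestronglyMeasurable R (hxB.mono fun ω hω => by
      rw [norm_norm]; exact hR _ hω)
  have hi2 : Integrable (fun ω => ‖x ω - θs‖ ^ 2) ν :=
    Integrable.of_bound (hm.pow_const 2).aestronglyMeasurable (R ^ 2) (hxB.mono fun ω hω => by
      rw [norm_pow, norm_norm]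
      have := hR _ hω
      gcongr)
  have hmeas : Measurable fun p : Ω × Z => ℓ (x p.1) p.2 - ℓ θs p.2 :=
    (h.meas.comp ((hx.comp measurable_fst).prodMk measurable_snd)).sub
      (h.meas.comp (measurable_const.prodMk measurable_snd))
  have hi3 : Integrable (fun p : Ω × Z => L * ‖x p.1 - θs‖) (ν.prod q) :=
    (hi1.comp_fst q).const_mul L
  have hle : ∀ᵐ p ∂(ν.prod q), ‖ℓ (x p.1) p.2 - ℓ θs p.2‖ ≤ L * ‖x p.1 - θs‖ := by
    filter_upwards [Measure.quasiMeasurePreserving_fst.ae hxB,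
      Measure.quasiMeasurePreserving_snd.ae h.ae_abs_sub_le] with p h1 h2
    exact h2 θs hθs _ h1
  have hi4 := hi3.mono' hmeas.aestronglyMeasurable hle
  refine ⟨hi4, hi2, ?_⟩
  calc _ ≤ ∫ p, L * ‖x p.1 - θs‖ ∂(ν.prod q) :=
        integral_mono_ae hi4 hi3 (hle.mono fun p hp => (le_abs_self _).trans hp)
    _ = L * ∫ ω, ‖x ω - θs‖ ∂ν := by
        rw [integral_const_mul, integral_fun_fst (fun ω => ‖x ω - θs‖)]
        simp
    _ ≤ _ := by
        gcongr
        exact integral_le_sqrt_integral_sq hν hi1 hi2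

/-- For polynomial steps the lower-order terms of the bound for the averaged iterate are `o(√k)`. -/
theorem remainder_isLittleO {c α : ℝ} (hc : 0 < c) (hα : 1 / 2 < α) (hα' : α < 1) {η : ℕ → ℝ}
    (hη : ∀ k, η k = c * ((k : ℝ) + 1) ^ (-α)) {a C K : ℝ} (ha : 0 ≤ a) (L : ℝ) :
    (fun k : ℕ => √(∑ i ∈ Finset.range (k + 1), a * √(C * η i)) +
      ∑ i ∈ Finset.range (k + 1), K * (√C * η i) + 3 * √C * (√(η k))⁻¹ + L) =o[atTop]
        fun k : ℕ => √((k : ℝ) + 1) := by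
  have hη' : η = fun k : ℕ => c * ((k : ℝ) + 1) ^ (-α) := funext hη
  have hη0 : Tendsto η atTop (𝓝 0) := hη' ▸ tendsto_polynomial_step (by linarith)
  have hx0 : ∀ k : ℕ, 0 < (k : ℝ) + 1 := fun k => by positivity
  have hpow : ∀ β : ℝ, β < 0 → Tendsto (fun k : ℕ => ((k : ℝ) + 1) ^ β) atTop (𝓝 0) :=
    fun β hβ => by
      have := (tendsto_rpow_neg_atTop (neg_pos.2 hβ)).comp tendsto_natCast_add_one_atTop
      simpa [Function.comp_def] using this
  have hrpow : ∀ β γ : ℝ, β < γ → (fun k : ℕ => ((k : ℝ) + 1) ^ β) =o[atTop]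
      fun k : ℕ => ((k : ℝ) + 1) ^ γ := fun β γ hβγ => by
    rw [isLittleO_iff_tendsto' (Eventually.of_forall fun k hk =>
      absurd hk (Real.rpow_pos_of_pos (hx0 k) γ).ne')]
    refine (hpow (β - γ) (by linarith)).congr fun k => ?_
    rw [Real.rpow_sub (hx0 k)]
  have hsqrt : (fun k : ℕ => √((k : ℝ) + 1)) = fun k : ℕ => ((k : ℝ) + 1) ^ (1 / 2 : ℝ) :=
    funext fun k => Real.sqrt_eq_rpow _
  have hinvsqrt : (fun k : ℕ => 1 / √((k : ℝ) + 1)) =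
      fun k : ℕ => ((k : ℝ) + 1) ^ (-(1 / 2) : ℝ) := funext fun k => by
    rw [Real.sqrt_eq_rpow, Real.rpow_neg (hx0 k).le, one_div]
  have h1 : (fun k : ℕ => √(∑ i ∈ Finset.range (k + 1), a * √(C * η i))) =o[atTop]
      fun k : ℕ => √((k : ℝ) + 1) := by
    refine isLittleO_sqrt (isLittleO_sum_of_tendsto_zero ?_)
      (fun k => Finset.sum_nonneg fun i _ => by positivity) fun k => (hx0 k).le
    have h0 : Tendsto (fun k => a * √(C * η k)) atTop (𝓝 (a * √(C * 0))) :=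
      ((Real.continuous_sqrt.tendsto _).comp (hη0.const_mul C)).const_mul a
    simpa using h0
  have h2 : (fun k : ℕ => ∑ i ∈ Finset.range (k + 1), K * (√C * η i)) =o[atTop]
      fun k : ℕ => √((k : ℝ) + 1) := by
    refine isLittleO_sum_of_isLittleO_one_div_sqrt ?_
    rw [hinvsqrt, hη']
    -- This is where α > 1/2 enters: η_i = o(i^(-1/2)), so the quadratic remainders sum to o(√k).
    exact (((hrpow (-α) (-(1 / 2)) (by linarith)).const_mul_left c).const_mul_left √C).const_mul_left
      K
  have h3 : (fun k : ℕ => 3 * √C * (√(η k))⁻¹) =o[atTop] fun k : ℕ => √((k : ℝ) + 1) := by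
    have e : ∀ k : ℕ, (√(η k))⁻¹ = (√c)⁻¹ * ((k : ℝ) + 1) ^ (α / 2) := fun k => by
      rw [hη, Real.sqrt_mul hc.le, mul_inv, Real.sqrt_eq_rpow (_ ^ _), ← Real.rpow_mul (hx0 k).le,
        ← Real.rpow_neg (hx0 k).le]
      congr 2
      ring
    simp only [e]
    rw [hsqrt]
    -- η_k^(-1/2) has order k^(α/2), which is o(√k) since α < 1.
    exact ((hrpow (α / 2) (1 / 2) (by linarith)).const_mul_left _).const_mul_left _
  have h4 : (fun _ : ℕ => L) =o[atTop] fun k : ℕ => √((k : ℝ) + 1) := by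
    rw [hsqrt]
    have h0 := hrpow 0 (1 / 2) (by norm_num)
    simp only [Real.rpow_zero] at h0
    simpa using h0.const_mul_left L
  exact ((h1.add h2).add h3).add h4

/-- The indicator of A_k is expressed by restricting `P` to `stayIn B θ k`, and the independent
sample (x, y) by the product with `q`. Integrability is asserted as well, since the integral of a
non-integrable function is 0 by convention. -/
theorem theorem3
    {d : ℕ} {X Y Ω : Type*} [MeasurableSpace X] [MeasurableSpace Y] [mΩ : MeasurableSpace Ω]
    -- the data distribution `q`, the loss `ℓ` and the model's conditional distributions `κ θ`
    (q : Measure (X × Y)) [IsProbabilityMeasure q]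
    (ℓ : Param d → X × Y → ℝ)
    (hℓ_meas : Measurable fun p : Param d × (X × Y) => ℓ p.1 p.2)
    (hgrad_meas : Measurable fun p : Param d × (X × Y) => sampleGrad ℓ p.2 p.1)
    (κ : Param d → Kernel X Y) [∀ θ, IsMarkovKernel (κ θ)]
    -- the local minimum `θs` of the expected loss and the compact set `B` around it
    (θs : Param d) (B : Set (Param d))
    (hB_compact : IsCompact B) (hB_convex : Convex ℝ B) (hθs : θs ∈ interior B)
    (hℓ_int : ∀ θ ∈ B, Integrable (ℓ θ) q)
    (hmin : IsLocalMin (expectedLoss ℓ q) θs)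
    -- realizability
    (hreal : modelDistribution q κ θs = q)
    -- differentiability on `B`, with gradients bounded by `L`
    (L : ℝ)
    (hdiff : ∀ᵐ z ∂q, ∀ θ ∈ B, DifferentiableAt ℝ (fun ϑ => ℓ ϑ z) θ)
    (hL : ∀ᵐ z ∂q, ∀ θ ∈ B, ‖sampleGrad ℓ z θ‖ ≤ L)
    -- positive definiteness of the Hessian, the Fisher information and the gradient covariance
    (hH : ∀ θ ∈ B, (meanHessian ℓ q θ).PosDef)
    (hF : ∀ θ ∈ B, (fisherMatrix ℓ q κ θ).PosDef)
    (hC : ∀ θ ∈ B, (gradCovariance ℓ q θ).PosDef)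
    -- strong convexity of the expected loss on `B`
    (μ : ℝ) (hμ : 0 < μ) (hsc : StrongConvexOn B μ (expectedLoss ℓ q))
    -- smoothness: Lipschitz gradients, and Lipschitz Hessians, on `B`
    (K₁ K₂ : ℝ≥0)
    (hgrad_lip : ∀ᵐ z ∂q, LipschitzOnWith K₁ (sampleGrad ℓ z) B)
    (hdiff2 : ∀ᵐ z ∂q, ∀ θ ∈ B, DifferentiableAt ℝ (sampleGrad ℓ z) θ)
    (hhess_lip : ∀ᵐ z ∂q, LipschitzOnWith K₂ (sampleHess ℓ z) B)
    -- the step sizes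
    (c α : ℝ) (hc : 0 < c) (hα : 1 / 2 < α) (hα' : α < 1)
    (η : ℕ → ℝ) (hη : ∀ k, η k = c * ((k : ℝ) + 1) ^ (-α))
    -- the mini-batches: nonempty, each element distributed as `q`, independent of the past
    (P : Measure Ω) [IsProbabilityMeasure P] (ℱ : Filtration ℕ mΩ)
    (b : ℕ → ℕ) (hb : ∀ k, 0 < b k)
    (D : (k : ℕ) → Ω → Fin (b k) → X × Y)
    (hD_meas : ∀ k, Measurable[ℱ (k + 1)] (D k))
    (hD_law : ∀ k j, P.map (fun ω => D k ω j) = q)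
    (hD_indep : ∀ k, Indep (MeasurableSpace.comap (D k) inferInstance) (ℱ k) P)
    -- the initial weight
    (init : Ω → Param d) (hinit_meas : Measurable[ℱ 0] init)
    (hinit : ∀ᵐ ω ∂P, init ω ∈ B)
    -- the iterates and their averages
    (θ : ℕ → Ω → Param d) (hθ : θ = sgd ℓ η b D init)
    (θbar : ℕ → Ω → Param d) (hθbar : θbar = averageIterate θ) :
    ∃ r : ℕ → ℝ, (r =o[atTop] fun k : ℕ => 1 / √((k : ℝ) + 1)) ∧
      ∀ k : ℕ,
        -- the bound for the SGD run as long as it stays in `B`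
        (Integrable (fun p : Ω × (X × Y) => ℓ (θbar k p.1) p.2 - ℓ θs p.2)
            ((P.restrict (stayIn B θ k)).prod q) ∧
          Integrable (fun ω => ‖θbar k ω - θs‖ ^ 2) (P.restrict (stayIn B θ k)) ∧
          ∫ p, (ℓ (θbar k p.1) p.2 - ℓ θs p.2) ∂((P.restrict (stayIn B θ k)).prod q)
            ≤ L * √(∫ ω in stayIn B θ k, ‖θbar k ω - θs‖ ^ 2 ∂P) ∧
          L * √(∫ ω in stayIn B θ k, ‖θbar k ω - θs‖ ^ 2 ∂P)
            ≤ L * ((fisherMatrix ℓ q κ θs)⁻¹.trace * √((gradCovariance ℓ q θs).trace)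
                / √((k : ℝ) + 1)) + r k) ∧
        -- the bound with full expectations, when the iterates stay in `B` almost surely
        ((∀ᵐ ω ∂P, ω ∈ stayIn B θ k) →
          Integrable (fun p : Ω × (X × Y) => ℓ (θbar k p.1) p.2 - ℓ θs p.2) (P.prod q) ∧
          Integrable (fun ω => ‖θbar k ω - θs‖ ^ 2) P ∧
          ∫ p, (ℓ (θbar k p.1) p.2 - ℓ θs p.2) ∂(P.prod q)
            ≤ L * √(∫ ω, ‖θbar k ω - θs‖ ^ 2 ∂P) ∧
          L * √(∫ ω, ‖θbar k ω - θs‖ ^ 2 ∂P)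
            ≤ L * ((fisherMatrix ℓ q κ θs)⁻¹.trace * √((gradCovariance ℓ q θs).trace)
                / √((k : ℝ) + 1)) + r k) := by
  have hs := interior_subset hθs
  have hreg : RegularLoss ℓ q B L K₁ K₂ :=
    ⟨hℓ_meas, hgrad_meas, hB_convex, hB_compact, hℓ_int, hdiff, hL, hgrad_lip, hdiff2, hhess_lip⟩
  have hfresh : ∀ k, FreshBatch (ℱ k) P q (D k) := fun k =>
    ⟨hb k, (hD_meas k).mono (ℱ.le _) le_rfl, hD_law k, hD_indep k⟩
  have hstep : ∀ k ω, θ (k + 1) ω = θ k ω - η k • batchGrad ℓ (D k ω) (θ k ω) := fun k ω => by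
    subst hθ; rfl
  have hθ_meas : ∀ k, Measurable[ℱ k] (θ k) := fun k => by
    induction k with
    | zero => subst hθ; exact hinit_meas
    | succ k ih =>
      have hk := ih.mono (ℱ.mono k.le_succ) le_rfl
      rw [funext (hstep k)]
      exact hk.sub ((hreg.measurable_batchGrad hk (hD_meas k)).const_smul (η k))
  have hR : SGDRun ℓ q P ℱ η D θ := ⟨hstep, hθ_meas, hD_meas, hfresh⟩
  -- Realizability at θs is what lets the Fisher matrix replace the Hessian that the dynamics
  -- produce.
  have hfisher : fisherMatrix ℓ q κ θs = meanHessian ℓ q θs := by rw [fisherMatrix, hreal]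
  have hpos : ∀ k, 0 < η k := fun k => by rw [hη]; positivity
  have hanti : Antitone η := fun i j hij => by
    rw [hη, hη]
    gcongr ?_ * ?_
    refine Real.rpow_le_rpow_of_nonpos (by positivity) ?_ (by linarith)
    gcongr
  have hη' : η = fun k : ℕ => c * ((k : ℝ) + 1) ^ (-α) := funext hη
  have hη0 : Tendsto η atTop (𝓝 0) := hη' ▸ tendsto_polynomial_step (by linarith)
  have hslow : ∀ ε > 0, ∀ᶠ k in atTop, η k * (1 - ε * η k) ≤ η (k + 1) := fun ε hε => by
    rw [hη']
    exact polynomial_step_slow hc (by linarith) hα' hε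
  have hG := hreg.meanGrad_eq_zero hθs hmin
  have hL0 := hreg.bound_nonneg ⟨θs, hs⟩
  obtain ⟨C, hC0, hu, hv⟩ := hR.exists_moment_bounds hreg hθs hmin hμ hsc hpos hη0 hslow
  set ρ : ℕ → ℝ := fun k => √(∑ i ∈ Finset.range (k + 1), 8 * L * K₁ * √(C * η i)) +
    ∑ i ∈ Finset.range (k + 1), K₂ * (√C * η i) + 3 * √C * (√(η k))⁻¹ + L with hρ
  have hρo : ρ =o[atTop] fun k : ℕ => √((k : ℝ) + 1) :=
    remainder_isLittleO hc hα hα' hη (by positivity) L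
  set τ := (meanHessian ℓ q θs)⁻¹.trace with hτ
  set T := (gradCovariance ℓ q θs).trace with hT
  have hmain : ∀ k, √(∫ ω in stayIn B θ k, ‖θbar k ω - θs‖ ^ 2 ∂P) ≤
      τ * √T / √((k : ℝ) + 1) + τ * (((k : ℝ) + 1)⁻¹ * ρ k) := by
    intro k
    have hk : 0 < (k : ℝ) + 1 := by positivity
    have hsm : Measurable fun ω => ∑ i ∈ Finset.range (k + 1), (θ i ω - θs) :=
      Finset.measurable_fun_sum _ fun i _ => (hR.measurable i).sub_const θs
    have key := hR.lpNorm_sum_sub_le hreg hθs hG (hH θs hs) hpos hanti hC0 hu hv k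
    rw [lpNorm_two_eq_sqrt hsm.aestronglyMeasurable] at key
    have e : ∀ ω, ‖θbar k ω - θs‖ ^ 2 = (((k : ℝ) + 1)⁻¹) ^ 2 *
        ‖∑ i ∈ Finset.range (k + 1), (θ i ω - θs)‖ ^ 2 := fun ω => by
      rw [hθbar, averageIterate_sub, norm_smul, mul_pow, Real.norm_of_nonneg (by positivity)]
    simp_rw [e]
    rw [integral_const_mul, Real.sqrt_mul (by positivity), Real.sqrt_sq (by positivity)]
    refine (mul_le_mul_of_nonneg_left key (by positivity)).trans_eq ?_
    have hsq : ((k : ℝ) + 1)⁻¹ = (√((k : ℝ) + 1))⁻¹ * (√((k : ℝ) + 1))⁻¹ := by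
      rw [← mul_inv, Real.mul_self_sqrt hk.le]
    have hne : √((k : ℝ) + 1) ≠ 0 := by positivity
    have h1 : ((k : ℝ) + 1)⁻¹ * √((k : ℝ) + 1) = (√((k : ℝ) + 1))⁻¹ := by
      rw [hsq, mul_assoc, inv_mul_cancel₀ hne, mul_one]
    calc _ = τ * √T * (((k : ℝ) + 1)⁻¹ * √((k : ℝ) + 1)) + τ * (((k : ℝ) + 1)⁻¹ * ρ k) := by
          simp only [hρ]; ring
      _ = _ := by rw [h1, div_eq_mul_inv]
  have hfirst : ∀ k, Integrable (fun p : Ω × (X × Y) => ℓ (θbar k p.1) p.2 - ℓ θs p.2)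
            ((P.restrict (stayIn B θ k)).prod q) ∧
          Integrable (fun ω => ‖θbar k ω - θs‖ ^ 2) (P.restrict (stayIn B θ k)) ∧
          ∫ p, (ℓ (θbar k p.1) p.2 - ℓ θs p.2) ∂((P.restrict (stayIn B θ k)).prod q)
            ≤ L * √(∫ ω in stayIn B θ k, ‖θbar k ω - θs‖ ^ 2 ∂P) ∧
          L * √(∫ ω in stayIn B θ k, ‖θbar k ω - θs‖ ^ 2 ∂P)
            ≤ L * ((fisherMatrix ℓ q κ θs)⁻¹.trace * √T / √((k : ℝ) + 1)) +
              L * τ * (((k : ℝ) + 1)⁻¹ * ρ k) := by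
    intro k
    have hbar_meas : Measurable (θbar k) := by
      have hsum : Measurable fun ω => ∑ i ∈ Finset.range (k + 1), θ i ω :=
        Finset.measurable_fun_sum _ fun i _ => hR.measurable i
      rw [hθbar]
      exact hsum.const_smul ((k : ℝ) + 1)⁻¹
    obtain ⟨i1, i2, i3⟩ := hreg.integral_excess_le hs (ν := P.restrict (stayIn B θ k))
      (by simp) hbar_meas
      ((ae_restrict_iff' (hR.measurableSet_stayIn' hreg k)).2 (Eventually.of_forall fun ω hω => by
        rw [hθbar]; exact averageIterate_mem hB_convex hω))
    refine ⟨i1, i2, i3, ?_⟩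
    rw [hfisher, ← hτ, mul_assoc L τ, ← mul_add]
    exact mul_le_mul_of_nonneg_left (hmain k) hL0
  -- The numerator ρ_k is o(√(k+1)), so division by k + 1 leaves o(1/√(k+1)).
  refine ⟨fun k => L * τ * (((k : ℝ) + 1)⁻¹ * ρ k), ?_, fun k => ⟨hfirst k, fun hk => ?_⟩⟩
  · refine IsLittleO.const_mul_left ?_ _
    refine ((isBigO_refl (fun k : ℕ => ((k : ℝ) + 1)⁻¹) atTop).mul_isLittleO hρo).congr_right
      fun k => ?_
    have hk : 0 < (k : ℝ) + 1 := by positivity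
    rw [inv_mul_eq_div, Real.sqrt_div_self', one_div]
  · have hfk := hfirst k
    -- If A_k has full measure, restricting `P` to it changes nothing, so the same r_k serves.
    rwa [Measure.restrict_eq_self_of_ae_mem hk] at hfk
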